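/- Notation. Let $\mathcal H=\{z=x+iy:\ y>0\}$, let $\mathcal D=\{z\in\mathcal H:\ |z|\ge 1,\ |x|\le \tfrac12\}$ be the standard fundamental domain of $SL(2,\mathbb Z)$, and for $T>0$ put $\mathcal D_T=\{z\in\mathcal D:\ y\le T\}$. Let $\xi(s)=\pi^{-s/2}\,\Gamma(s/2)\,\zeta(s)$ be the completed Riemann zeta function. For $\Re(s)>1$ let $$E(z,s)=\sum_{\gamma\in\Gamma_\infty\backslash SL(2,\mathbb Z)}\operatorname{Im}(\gamma z)^s,\qquad \widehat E(z,s)=\xi(2s)\,E(z,s),$$ where $\Gamma_\infty=\left\{\pm\begin{pmatrix}1&n\\0&1\end{pmatrix}: n\in\mathbb Z\right\}$ is the isotropy group of the cusp $\infty$, and for real $T\ge 1$ let $$\xi^T_{\mathbb Q,2}(s)=\int_{\mathcal D_T}\widehat E(z,s)\,\frac{dx\,dy}{y^2}.$$ For a rank two $\mathbb Z$-lattice $\Lambda$ in the Euclidean plane let $\mathrm{Vol}(\Lambda)$ be its covolume and $h^0(\mathbb Q,\Lambda)=\log\sum_{x\in\Lambda}e^{-\pi\|x\|^2}$. Call $\Lambda$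 semi-stable if $\mathrm{Vol}(\Lambda_1)^2\ge \mathrm{Vol}(\Lambda)$ for every rank one sublattice $\Lambda_1$ (where $\mathrm{Vol}(\Lambda_1)$ is the length of a generator). Rank two lattices are parametrized by $(SL(2,\mathbb Z)\backslash\mathcal H)\times\mathbb R_{>0}$, the pair $(z,t)$ with $z\in\mathcal D$ corresponding to $\Lambda_{z,t}=t\,y^{-1/2}(\mathbb Z z+\mathbb Z)\subset\mathbb C$. This space carries the measure $d\mu=\frac{dx\,dy}{y^2}\cdot\frac{dt}{t}$; let $\mathcal M_{\mathbb Q,2}$ be its subset of semi-stable lattices. The rank two non-abelian zeta function of $\mathbb Q$ is $$\xi_{\mathbb Q,2}(s)=\int_{\mathcal M_{\mathbb Q,2}}\bigl(e^{h^0(\mathbb Q,\Lambda)}-1\bigr)\,\mathrm{Vol}(\Lambda)^s\,d\mu(\Lambda),\qquad \Re(s)>1.$$ Statement. Let $\Re(s)>1$. The series $E(z,s)$ converges absolutely for every $z\in\mathcal H$. For every real $T\ge 1$ the integral defining $\xi^T_{\mathbb Q,2}(s)$ converges absolutely and $$\xi^T_{\mathbb Q,2}(s)=\frac{\xi(2s)}{s-1}\,T^{s-1}-\frac{\xi(2s-1)}{s}\,T^{-s}.$$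 In particular, the integral defining $\xi_{\mathbb Q,2}(s)$ converges absolutely and $$\xi_{\mathbb Q,2}(s)=\frac{\xi(2s)}{s-1}-\frac{\xi(2s-1)}{s}.$$ -/

import Mathlib

open MeasureTheory UpperHalfPlane

open scoped MatrixGroups Modular

noncomputable section

namespace RankTwoZeta

/-- The isotropy group `Γ_∞` in `SL(2, ℤ)` of the cusp `∞`: the matrices whose lower left entry
is zero, i.e. the `± (1 n; 0 1)`. -/
def GammaInf : Subgroup SL(2, ℤ) where
  carrier := {γ | γ 1 0 = 0}
  one_mem' := by simp
  mul_mem' := by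
    intro a b ha hb
    have ha' : a 1 0 = 0 := ha
    have hb' : b 1 0 = 0 := hb
    simp [Matrix.mul_apply, Fin.sum_univ_two, ha', hb']
  inv_mem' := by
    intro a ha
    have ha' : a 1 0 = 0 := ha
    change (a⁻¹).1 1 0 = 0
    rw [Matrix.SpecialLinearGroup.SL2_inv_expl]
    simp [ha']

theorem im_smul_of_mem_GammaInf {g : SL(2, ℤ)} (hg : g ∈ GammaInf) (z : ℍ) :
    (g • z).im = z.im := by
  have h10 : g 1 0 = 0 := hg
  have hdet : g 0 0 * g 1 1 = 1 := by
    have h := Matrix.det_fin_two g.1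
    rw [g.2] at h
    have h10' : g.1 1 0 = 0 := h10
    rw [h10', mul_zero, sub_zero] at h
    exact h.symm
  have hsq : g 1 1 * g 1 1 = 1 := by
    rcases Int.eq_one_or_neg_one_of_mul_eq_one' hdet with ⟨_, h⟩ | ⟨_, h⟩ <;> simp [h]
  have hsq' : ((g 1 1 : ℤ) : ℝ) * ((g 1 1 : ℤ) : ℝ) = 1 := by exact_mod_cast hsq
  rw [ModularGroup.im_smul_eq_div_normSq, ModularGroup.denom_apply, h10]
  simp [Complex.normSq_apply, hsq']

/-- The right cosets `Γ_∞ \ SL(2, ℤ)`. -/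
abbrev Cosets : Type := Quotient (QuotientGroup.rightRel GammaInf)

/-- The term `Im(γ z) ^ s`, as a function of the coset `Γ_∞ γ`. -/
def eisensteinTerm (z : ℍ) (s : ℂ) : Cosets → ℂ :=
  Quotient.lift (fun γ : SL(2, ℤ) => (((γ • z).im : ℝ) : ℂ) ^ s) (by
    intro a b hab
    have hm : b * a⁻¹ ∈ GammaInf := QuotientGroup.rightRel_apply.mp hab
    have h := im_smul_of_mem_GammaInf hm (a • z)
    rw [← mul_smul, inv_mul_cancel_right] at h
    simp only [h])

/-- The Eisenstein series `E(z, s) = ∑_{γ ∈ Γ_∞ \ SL(2, ℤ)} Im(γ z) ^ s`. -/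
def eisenstein (z : ℍ) (s : ℂ) : ℂ :=
  ∑' γ : Cosets, eisensteinTerm z s γ

/-- The completed Eisenstein series `Ê(z, s) = ξ(2s) E(z, s)`, where
`ξ(s) = π ^ (-s / 2) Γ(s / 2) ζ(s)`. -/
def eisensteinHat (z : ℍ) (s : ℂ) : ℂ :=
  completedRiemannZeta (2 * s) * eisenstein z s

/-- The truncated fundamental domain `𝒟_T`: the points `z` of the standard fundamental domain
`|z| ≥ 1, |Re z| ≤ 1 / 2` of `SL(2, ℤ)` with `Im z ≤ T`. -/
def truncatedDomain (T : ℝ) : Set ℍ := {z | z ∈ 𝒟 ∧ z.im ≤ T}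

/-- The truncated rank two zeta function `ξ^T_{ℚ,2}(s) = ∫_{𝒟_T} Ê(z, s) dx dy / y ^ 2`
(the standard measure on `ℍ` is `dx dy / y ^ 2`). -/
def truncatedZeta (T : ℝ) (s : ℂ) : ℂ :=
  ∫ z in truncatedDomain T, eisensteinHat z s

/-- The rank two `ℤ`-lattice `t · y ^ (-1/2) · (ℤ z + ℤ)` in the Euclidean plane `ℂ`, `y = Im z`.
For `t = 1` it is the lattice of volume one attached to `z`, and multiplying by `t` multiplies
its inner product by `t ^ 2`. -/
def lattice (z : ℍ) (t : ℝ) : Submodule ℤ ℂ :=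
  Submodule.span ℤ {((t / √z.im : ℝ) : ℂ) * (z : ℂ), ((t / √z.im : ℝ) : ℂ)}

/-- The volume of a rank two lattice in the Euclidean plane. -/
def vol (L : Submodule ℤ ℂ) : ℝ := ZLattice.covolume L

/-- `h⁰(ℚ, Λ) = log ∑_{x ∈ Λ} exp(-π ‖x‖ ^ 2)`. -/
def h0 (L : Submodule ℤ ℂ) : ℝ :=
  Real.log (∑' x : L, Real.exp (-Real.pi * ‖(x : ℂ)‖ ^ 2))

/-- Semi-stability of a rank two lattice `Λ`: every rank one sublattice `Λ₁` satisfies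
`Vol(Λ₁) ^ 2 ≥ Vol(Λ)`. The rank one sublattices are the `ℤ x` with `0 ≠ x ∈ Λ`,
and `Vol(ℤ x) = ‖x‖`. -/
def IsSemistable (L : Submodule ℤ ℂ) : Prop :=
  ∀ x ∈ L, x ≠ 0 → vol L ≤ ‖x‖ ^ 2

/-- The moduli space of semi-stable rank two `ℤ`-lattices, realized in
`(SL(2, ℤ) \ ℍ) × ℝ_{>0}` by means of the standard fundamental domain: the point `(z, t)`
stands for the lattice `lattice z t`. -/
def semistableModuli : Set (ℍ × ℝ) :=
  {p | p.1 ∈ 𝒟 ∧ 0 < p.2 ∧ IsSemistable (lattice p.1 p.2)}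

/-- The measure `(dx dy / y ^ 2) × (dt / t)` on the space of lattices. -/
def moduliMeasure : Measure (ℍ × ℝ) :=
  (volume : Measure ℍ).prod
    ((volume : Measure ℝ).withDensity fun t => ENNReal.ofReal t⁻¹)

/-- The integrand `(exp h⁰(ℚ, Λ) - 1) · Vol(Λ) ^ s` at `Λ = lattice z t`. -/
def zetaIntegrand (s : ℂ) (p : ℍ × ℝ) : ℂ :=
  ((Real.exp (h0 (lattice p.1 p.2)) - 1 : ℝ) : ℂ) * ((vol (lattice p.1 p.2) : ℝ) : ℂ) ^ s

/-- The rank two non-abelian zeta function of `ℚ`: the integral of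
`(exp h⁰(ℚ, Λ) - 1) · Vol(Λ) ^ s` over the moduli space of semi-stable rank two lattices. -/
def nonabelianZeta (s : ℂ) : ℂ :=
  ∫ p in semistableModuli, zetaIntegrand s p ∂moduliMeasure

end RankTwoZeta

end

/-! The proof unfolds before truncating. The translates of `𝒟` by `T ^ n γ`, with `γ` running over
coset representatives, tile `ℍ` up to null sets. Hence the map `(z, c) ↦ Im (c z)` carries the
measure on `𝒟` × cosets to `y⁻² dy` on `(0, ∞)` (`map_cosetIm`). Now restrict to image height at
most `T`. The trivial coset keeps the height of `z`, and every other coset sends `𝒟` below height `1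
≤ T`. So the preimage consists of `𝒟_T` with all cosets, and the cusp `y > T` with the nontrivial
ones. This gives (`unfolding`) `∫_{𝒟_T} E + ∫_{y > T} (E - y ^ s) = ∫_0^T y ^ (s - 2) dy = T ^ (s -
1) / (s - 1)`.

The cusp term is computed directly, without a Fourier expansion. Multiplication by `2 ζ(2s)` turns
the sum over nontrivial cosets into a sum of `(y / |m z + n| ^ 2) ^ s` over `m ≠ 0` and all `n`
(`tsum_quad_big`). Summing over `n` unrolls `|x| ≤ 1/2` to the whole line, and scaling separates the
variables (`tsum_lintegral_quad`). What remains is `2 ζ(2s - 1) · T ^ (-s) / s · ∫ (1 + w ^ 2) ^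
(-s) dw`, and the last integral is a quotient of Gamma values (`Gamma_mul_integral_inv_one_add_sq`).

For the non-abelian zeta function, a lattice with `z ∈ 𝒟` is semi-stable exactly when `Im z ≤ 1`.
The integral over the scale `t` is the Mellin transform of a theta series and equals `Ê(z, s)`
(`integral_tsum_mellinTerm`). So this zeta function is the truncated one at `T = 1`. -/

namespace RankTwoZeta

/-! ### Invariant measure on the upper half-plane and the boundary of the fundamental domain -/

/-- Integration over the upper half-plane in the coordinates `x`, `y`. -/
theorem lintegral_re_im {f : ℝ × ℝ → ENNReal} (hf : Measurable f) :
    ∫⁻ z : ℍ, f (z.re, z.im) =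
      ∫⁻ y in Set.Ioi (0 : ℝ), (∫⁻ x : ℝ, f (x, y)) * ENNReal.ofReal (y ^ 2)⁻¹ := by
  have hpres : MeasurePreserving UpperHalfPlane.coe
      ((volume : Measure ℂ).comap UpperHalfPlane.coe)
      ((volume : Measure ℂ).restrict (.range UpperHalfPlane.coe)) :=
    ⟨measurable_coe, by rw [measurableEmbedding_coe.map_comap]⟩
  have hrange : Set.range UpperHalfPlane.coe = {w : ℂ | 0 < w.im} := by
    ext w
    exact ⟨by rintro ⟨z, rfl⟩; exact z.im_pos, fun h => ⟨⟨w, h⟩, rfl⟩⟩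
  have hdens : Measurable fun z : ℍ =>
      (((1 / NNReal.mk z.im z.im_pos.le : NNReal) ^ 2 : NNReal) : ENNReal) := by
    refine (Measurable.pow_const (Measurable.const_div ?_ _) _).coe_nnreal_ennreal
    exact (continuous_im.subtype_mk _).measurable
  have hfm : Measurable fun z : ℍ => f (z.re, z.im) :=
    hf.comp (continuous_re.measurable.prodMk continuous_im.measurable)
  have hg : Measurable fun q : ℝ × ℝ => f q * ENNReal.ofReal (q.2 ^ 2)⁻¹ := by fun_prop
  rw [volume_def, lintegral_withDensity_eq_lintegral_mul _ hdens hfm]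
  have h1 : ∀ z : ℍ, (((fun z : ℍ =>
      (((1 / NNReal.mk z.im z.im_pos.le : NNReal) ^ 2 : NNReal) : ENNReal)) *
      fun z : ℍ => f (z.re, z.im)) z) =
      (fun w : ℂ => (fun q : ℝ × ℝ => f q * ENNReal.ofReal (q.2 ^ 2)⁻¹)
        (Complex.measurableEquivRealProd w)) (z : ℂ) := by
    intro z
    rw [Pi.mul_apply, mul_comm]
    change _ = f (z.re, z.im) * ENNReal.ofReal (z.im ^ 2)⁻¹
    refine congrArg (f (z.re, z.im) * ·) ?_
    rw [← ENNReal.ofReal_coe_nnreal]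
    congr 1
    push_cast
    rw [one_div, inv_pow]
  rw [lintegral_congr h1, hpres.lintegral_comp_emb measurableEmbedding_coe
    (fun w : ℂ => (fun q : ℝ × ℝ => f q * ENNReal.ofReal (q.2 ^ 2)⁻¹)
        (Complex.measurableEquivRealProd w)), hrange]
  have hset : {w : ℂ | 0 < w.im} =
      Complex.measurableEquivRealProd ⁻¹' (Set.univ ×ˢ Set.Ioi (0 : ℝ)) := by
    ext w; simp [Complex.measurableEquivRealProd_apply]
  rw [hset, Complex.volume_preserving_equiv_real_prod.setLIntegral_comp_preimage
    (MeasurableSet.univ.prod measurableSet_Ioi) hg, Measure.volume_eq_prod,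
    ← Measure.prod_restrict, lintegral_prod_symm _ hg.aemeasurable, Measure.restrict_univ]
  refine lintegral_congr fun y => ?_
  have hy : Measurable fun x : ℝ => f (x, y) :=
    hf.comp (measurable_id.prodMk measurable_const)
  exact lintegral_mul_const (ENNReal.ofReal (y ^ 2)⁻¹) hy

theorem measurePreserving_SL2Z_smul (γ : SL(2, ℤ)) :
    MeasurePreserving (fun z : ℍ => γ • z) :=
  measurePreserving_smul (γ : GL (Fin 2) ℝ) (volume : Measure ℍ)

theorem countable_SL2Z : Countable SL(2, ℤ) :=
  Function.Injective.countable (f := fun γ : SL(2, ℤ) => fun i j => γ.1 i j) fun _ _ h =>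
    Subtype.ext (Matrix.ext fun i j => congrFun (congrFun h i) j)

instance : Countable Cosets :=
  have := countable_SL2Z
  inferInstanceAs (Countable (Quotient _))

theorem measurableSet_fd : MeasurableSet (𝒟 : Set ℍ) := ModularGroup.isClosed_fd.measurableSet

/-- The boundary lies on the unit circle and two vertical lines, so each horizontal slice has at
most four points and Fubini applies. -/
theorem volume_fd_diff_fdo : volume ((𝒟 : Set ℍ) \ 𝒟ᵒ) = 0 := by
  set B : Set (ℝ × ℝ) := {q | q.1 ^ 2 + q.2 ^ 2 = 1 ∨ |q.1| = 1 / 2} with hB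
  have hBm : MeasurableSet B :=
    (measurableSet_eq_fun (by fun_prop) (by fun_prop)).union
      (measurableSet_eq_fun (by fun_prop) (by fun_prop))
  have hsub : (𝒟 : Set ℍ) \ 𝒟ᵒ ⊆ (fun z : ℍ => (z.re, z.im)) ⁻¹' B := by
    rintro z ⟨⟨h1, h2⟩, h3⟩
    by_contra hc
    simp only [hB, Set.mem_preimage, Set.mem_ofPred_eq, not_or] at hc
    refine h3 ⟨lt_of_le_of_ne h1 fun h => hc.1 ?_, lt_of_le_of_ne h2 hc.2⟩
    rw [h, Complex.normSq_apply]
    change z.re ^ 2 + z.im ^ 2 = z.re * z.re + z.im * z.im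
    ring
  refine measure_mono_null hsub ?_
  have hmap : Measurable fun z : ℍ => (z.re, z.im) :=
    continuous_re.measurable.prodMk continuous_im.measurable
  rw [← lintegral_indicator_one (hmap hBm)]
  have := lintegral_re_im (f := B.indicator 1) (measurable_one.indicator hBm)
  refine Eq.trans ?_ (this.trans ?_)
  · rfl
  · refine lintegral_eq_zero_of_ae_eq_zero (Filter.Eventually.of_forall fun y => ?_)
    have hfin : ({x : ℝ | (x, y) ∈ B}).Finite := by
      refine Set.Finite.subset (s := ({√(1 - y ^ 2), -√(1 - y ^ 2), 1 / 2, -(1 / 2)} : Set ℝ))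
        (by simp) ?_
      rintro x (hx | hx)
      · have hx' : x ^ 2 = 1 - y ^ 2 := by
          change x ^ 2 + y ^ 2 = 1 at hx
          linarith
        rw [← hx', Real.sqrt_sq_eq_abs]
        rcases abs_choice x with h | h <;> simp [h]
      · change |x| = 1 / 2 at hx
        rcases (abs_eq (by norm_num)).1 hx with h | h <;> simp [h]
    have h0 : ∫⁻ x : ℝ, B.indicator (1 : ℝ × ℝ → ENNReal) (x, y) = 0 := by
      have : (fun x : ℝ => B.indicator (1 : ℝ × ℝ → ENNReal) (x, y)) =
          ({x : ℝ | (x, y) ∈ B}).indicator 1 := by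
        ext x; simp [Set.indicator_apply]
      rw [this, lintegral_indicator_one hfin.measurableSet]
      exact hfin.measure_zero _
    simp [h0]

/-! ### Tiling by translates of the fundamental domain, and unfolding -/

/-- The elements `T ^ n γ`, with `γ` running over representatives of `Γ_∞ \ SL(2, ℤ)`, form a system
of representatives of `SL(2, ℤ) / ± 1`. -/
noncomputable def transl (i : Cosets × ℤ) : SL(2, ℤ) := ModularGroup.T ^ i.2 * i.1.out

theorem neg_mem_GammaInf {g : SL(2, ℤ)} (hg : g ∈ GammaInf) : -g ∈ GammaInf := by
  have h : g 1 0 = 0 := hg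
  change (-g) 1 0 = 0
  simp [h]

theorem T_zpow_mem_GammaInf (n : ℤ) : ModularGroup.T ^ n ∈ GammaInf := by
  change (ModularGroup.T ^ n) 1 0 = 0
  rw [ModularGroup.coe_T_zpow]
  simp

theorem mem_GammaInf_cases {g : SL(2, ℤ)} (hg : g ∈ GammaInf) :
    ∃ n : ℤ, g = ModularGroup.T ^ n ∨ g = -ModularGroup.T ^ n := by
  have h10 : g 1 0 = 0 := hg
  have hdet := g.det_coe
  rw [Matrix.det_fin_two, h10, mul_zero, sub_zero] at hdet
  rcases Int.eq_one_or_neg_one_of_mul_eq_one' hdet with ⟨ha, hd⟩ | ⟨ha, hd⟩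
  · refine ⟨g 0 1, Or.inl ?_⟩
    ext i j
    rw [ModularGroup.coe_T_zpow]
    fin_cases i <;> fin_cases j <;> simp [ha, hd, h10]
  · refine ⟨-g 0 1, Or.inr ?_⟩
    ext i j
    rw [Matrix.SpecialLinearGroup.coe_neg, ModularGroup.coe_T_zpow]
    fin_cases i <;> fin_cases j <;> simp [ha, hd, h10]

theorem exists_transl (g : SL(2, ℤ)) : ∃ i, g = transl i ∨ g = -transl i := by
  set c : Cosets := Quotient.mk _ g with hc
  have hrel : (QuotientGroup.rightRel GammaInf) c.out g := Quotient.mk_out g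
  have hm : g * (c.out)⁻¹ ∈ GammaInf := QuotientGroup.rightRel_apply.mp hrel
  obtain ⟨n, h | h⟩ := mem_GammaInf_cases hm
  · exact ⟨(c, n), Or.inl (by rw [transl, ← h, inv_mul_cancel_right])⟩
  · refine ⟨(c, n), Or.inr ?_⟩
    rw [transl, ← neg_mul, ← h, inv_mul_cancel_right]

theorem transl_injective_of_neg {i j : Cosets × ℤ}
    (h : transl i = transl j ∨ transl i = -transl j) : i = j := by
  obtain ⟨c, n⟩ := i
  obtain ⟨d, m⟩ := j
  have hcd : c = d := by
    have hm : d.out * (c.out)⁻¹ ∈ GammaInf := by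
      rcases h with h | h
      · have : d.out * (c.out)⁻¹ = ModularGroup.T ^ (-m) * ModularGroup.T ^ n := by
          rw [mul_inv_eq_iff_eq_mul, mul_assoc]
          change _ = _ * transl (c, n)
          rw [h, transl, zpow_neg, inv_mul_cancel_left]
        rw [this]
        exact GammaInf.mul_mem (T_zpow_mem_GammaInf _) (T_zpow_mem_GammaInf _)
      · have : d.out * (c.out)⁻¹ = -(ModularGroup.T ^ (-m) * ModularGroup.T ^ n) := by
          rw [mul_inv_eq_iff_eq_mul, neg_mul, mul_assoc]
          change _ = -(_ * transl (c, n))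
          rw [h, transl, zpow_neg, mul_neg, neg_neg, inv_mul_cancel_left]
        rw [this]
        exact neg_mem_GammaInf (GammaInf.mul_mem (T_zpow_mem_GammaInf _) (T_zpow_mem_GammaInf _))
    have : (QuotientGroup.rightRel GammaInf) c.out d.out := QuotientGroup.rightRel_apply.mpr hm
    rw [← c.out_eq, ← d.out_eq]
    exact Quotient.sound this
  subst hcd
  have hT : ModularGroup.T ^ n = ModularGroup.T ^ m ∨ ModularGroup.T ^ n = -ModularGroup.T ^ m := by
    rcases h with h | h
    · exact Or.inl (mul_right_cancel h)
    · rw [transl, transl, ← neg_mul] at h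
      exact Or.inr (mul_right_cancel h)
  -- The upper left entry rules out the sign, and the upper right entry recovers the exponent.
  have e : ∀ k : ℤ, (ModularGroup.T ^ k) 0 1 = k ∧ (ModularGroup.T ^ k) 0 0 = 1 := by
    intro k
    rw [ModularGroup.coe_T_zpow]
    simp
  rcases hT with h | h
  · have := congrArg (fun g : SL(2, ℤ) => g 0 1) h
    simp only [(e _).1] at this
    rw [this]
  · have := congrArg (fun g : SL(2, ℤ) => g 0 0) h
    simp only [Matrix.SpecialLinearGroup.coe_neg, Matrix.neg_apply, (e _).2] at this
    omega

/-- Discard the countably many null translates of the boundary. For the other points, any orbit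
representative in `𝒟` lies in `𝒟ᵒ`, where the group element is determined up to sign. -/
theorem ae_existsUnique_transl :
    ∀ᵐ z : ℍ, ∃! i : Cosets × ℤ, (transl i)⁻¹ • z ∈ (𝒟 : Set ℍ) := by
  have := countable_SL2Z
  have hnull : ∀ᵐ z : ℍ, ∀ γ : SL(2, ℤ), γ • z ∉ (𝒟 : Set ℍ) \ 𝒟ᵒ := by
    rw [ae_all_iff]
    intro γ
    have h0 := (measurePreserving_SL2Z_smul γ).quasiMeasurePreserving.preimage_null
      volume_fd_diff_fdo
    exact measure_eq_zero_iff_ae_notMem.1 h0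
  filter_upwards [hnull] with z hz
  obtain ⟨γ, hγ⟩ := ModularGroup.exists_smul_mem_fd z
  obtain ⟨i, hi⟩ := exists_transl γ⁻¹
  have hi' : (transl i)⁻¹ • z = γ • z := by
    rcases hi with h | h
    · rw [← h, inv_inv]
    · rw [← neg_eq_iff_eq_neg] at h
      have : (transl i)⁻¹ = -γ := by rw [← h]; simp
      rw [this, ModularGroup.SL_neg_smul]
  refine ⟨i, by simpa only [hi'] using hγ, fun j hj => ?_⟩
  have hfdo : (transl i)⁻¹ • z ∈ 𝒟ᵒ := by
    by_contra hc
    exact hz (transl i)⁻¹ ⟨by rw [hi']; exact hγ, hc⟩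
  have hj' : ((transl j)⁻¹ * transl i) • ((transl i)⁻¹ • z) ∈ (𝒟 : Set ℍ) := by
    rwa [← mul_smul, mul_inv_cancel_right]
  have := ModularGroup.eq_one_or_neg_one_of_mem_fdo_mem_fd hfdo hj'
  refine (transl_injective_of_neg ?_).symm
  rcases this with h | h
  · exact Or.inl (inv_mul_eq_one.1 h).symm
  · right
    rw [inv_mul_eq_iff_eq_mul] at h
    rw [h, mul_neg, mul_one]

theorem lintegral_eq_tsum_transl {F : ℍ → ENNReal} (hF : Measurable F) :
    ∫⁻ z, F z = ∑' i, ∫⁻ z in (𝒟 : Set ℍ), F (transl i • z) := by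
  have hmeas : ∀ i, Measurable fun z : ℍ => (transl i)⁻¹ • z := fun i =>
    (measurePreserving_SL2Z_smul _).measurable
  have h1 : ∀ i, ∫⁻ z in (𝒟 : Set ℍ), F (transl i • z) =
      ∫⁻ z, (𝒟 : Set ℍ).indicator 1 ((transl i)⁻¹ • z) * F z := by
    intro i
    have hG : Measurable fun z : ℍ => (𝒟 : Set ℍ).indicator (1 : ℍ → ENNReal) ((transl i)⁻¹ • z) *
        F z := ((measurable_one.indicator measurableSet_fd).comp (hmeas i)).mul hF
    rw [← (measurePreserving_SL2Z_smul (transl i)).lintegral_comp hG,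
      ← lintegral_indicator measurableSet_fd]
    refine lintegral_congr fun z => ?_
    simp only [inv_smul_smul]
    by_cases hz : z ∈ (𝒟 : Set ℍ) <;> simp [hz]
  simp_rw [h1]
  rw [← lintegral_tsum (f := fun (i : Cosets × ℤ) (z : ℍ) =>
    (𝒟 : Set ℍ).indicator 1 ((transl i)⁻¹ • z) * F z) fun i =>
    (((measurable_one.indicator measurableSet_fd).comp (hmeas i)).mul hF).aemeasurable]
  refine lintegral_congr_ae ?_
  filter_upwards [ae_existsUnique_transl] with z ⟨i, hi, hu⟩
  rw [ENNReal.tsum_mul_right, tsum_eq_single i, Set.indicator_of_mem hi, Pi.one_apply, one_mul]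
  intro j hj
  exact Set.indicator_of_notMem (fun h => hj (hu j h)) _

/-- Unfolding for functions of the imaginary part. -/
theorem tsum_lintegral_fd_im {f : ℝ → ENNReal} (hf : Measurable f) :
    ∑' c : Cosets, ∫⁻ z in (𝒟 : Set ℍ), f (c.out • z).im =
      ∫⁻ y in Set.Ioi (0 : ℝ), f y * ENNReal.ofReal (y ^ 2)⁻¹ := by
  set A : Set ℍ := {z | z.re ∈ Set.Ico (0 : ℝ) 1} with hA
  have hAm : MeasurableSet A := continuous_re.measurable measurableSet_Ico
  have hfm : Measurable fun z : ℍ => f z.im := hf.comp continuous_im.measurable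
  have key := lintegral_eq_tsum_transl (F := fun z => A.indicator 1 z * f z.im)
    ((measurable_one.indicator hAm).mul hfm)
  have hl : ∫⁻ z : ℍ, A.indicator 1 z * f z.im =
      ∫⁻ y in Set.Ioi (0 : ℝ), f y * ENNReal.ofReal (y ^ 2)⁻¹ := by
    have := lintegral_re_im (f := fun q => (Set.Ico (0 : ℝ) 1).indicator 1 q.1 * f q.2)
      (((measurable_one.indicator measurableSet_Ico).comp measurable_fst).mul
        (hf.comp measurable_snd))
    refine Eq.trans ?_ (this.trans ?_)
    · rfl
    · refine lintegral_congr fun y => ?_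
      dsimp only
      rw [lintegral_mul_const _ (measurable_one.indicator measurableSet_Ico),
        lintegral_indicator_one measurableSet_Ico]
      simp
  rw [← hl, key, ENNReal.tsum_prod (f := fun c n => ∫⁻ z in (𝒟 : Set ℍ), A.indicator 1 (transl (c, n) • z) *
    f (transl (c, n) • z).im)]
  refine tsum_congr fun c => ?_
  have hsm : Measurable fun z : ℍ => c.out • z := (measurePreserving_SL2Z_smul _).measurable
  rw [← lintegral_tsum]
  · refine lintegral_congr fun z => ?_
    have hsimp : ∀ n : ℤ, A.indicator (1 : ℍ → ENNReal) (transl (c, n) • z) *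
        f (transl (c, n) • z).im =
        A.indicator (1 : ℍ → ENNReal) (ModularGroup.T ^ n • (c.out • z)) * f (c.out • z).im := by
      intro n
      rw [transl, mul_smul, ModularGroup.im_T_zpow_smul]
    simp_rw [hsimp]
    -- Exactly one integer translation brings a point into the strip `0 ≤ x < 1`.
    rw [ENNReal.tsum_mul_right, tsum_eq_single (-⌊(c.out • z).re⌋), Set.indicator_of_mem,
      Pi.one_apply, one_mul]
    · simp only [hA, Set.mem_ofPred_eq, ModularGroup.re_T_zpow_smul, Set.mem_Ico, Int.cast_neg]
      exact ⟨by linarith [Int.floor_le (c.out • z).re],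
        by linarith [Int.lt_floor_add_one (c.out • z).re]⟩
    · intro n hn
      refine Set.indicator_of_notMem (fun h => hn ?_) _
      simp only [hA, Set.mem_ofPred_eq, ModularGroup.re_T_zpow_smul, Set.mem_Ico] at h
      have : ⌊(c.out • z).re⌋ = -n := by
        rw [Int.floor_eq_iff]
        push_cast
        exact ⟨by linarith, by linarith⟩
      omega
  · intro n
    have ht : Measurable fun z : ℍ => transl (c, n) • z :=
      (measurePreserving_SL2Z_smul _).measurable
    exact (((measurable_one.indicator hAm).comp ht).mul (hfm.comp ht)).aemeasurable

/-! ### Unfolding as an image measure on the half-line -/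

theorem integrable_tsum_of_prod_count {α ι : Type*} [MeasurableSpace α] [Countable ι]
    [MeasurableSpace ι] [MeasurableSingletonClass ι] {μ : Measure α} [SFinite μ] {F : α × ι → ℂ}
    (hF : Integrable F (μ.prod Measure.count)) :
    Integrable (fun a => ∑' i, F (a, i)) μ ∧
      ∫ a, ∑' i, F (a, i) ∂μ = ∫ p, F p ∂(μ.prod Measure.count) := by
  have h : (fun a => ∫ i, F (a, i) ∂Measure.count) =ᵐ[μ] fun a => ∑' i, F (a, i) := by
    filter_upwards [hF.prod_right_ae] with a ha
    rw [integral_countable ha]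
    simp
  exact ⟨hF.integral_prod_left.congr h, by rw [integral_prod F hF, integral_congr_ae h]⟩

instance : MeasurableSpace Cosets := ⊤

instance : DiscreteMeasurableSpace Cosets := ⟨fun _ => trivial⟩

/-- The imaginary part of the translate of `z` by a representative of a coset. -/
noncomputable def cosetIm (p : ℍ × Cosets) : ℝ := (p.2.out • p.1).im

theorem eisensteinTerm_eq (z : ℍ) (s : ℂ) (c : Cosets) :
    eisensteinTerm z s c = (cosetIm (z, c) : ℂ) ^ s := by
  conv_lhs => rw [← c.out_eq]
  rfl

theorem cosetIm_pos (p : ℍ × Cosets) : 0 < cosetIm p := (p.2.out • p.1).im_pos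

theorem measurable_cosetIm : Measurable cosetIm :=
  measurable_from_prod_countable_left fun c =>
    continuous_im.measurable.comp (measurePreserving_SL2Z_smul c.out).measurable

/-- The measure `y ^ (-2) dy` on the positive half-line. -/
noncomputable def imMeasure : Measure ℝ :=
  ((volume : Measure ℝ).restrict (Set.Ioi 0)).withDensity fun y => ENNReal.ofReal (y ^ 2)⁻¹

/-- This is `tsum_lintegral_fd_im` tested on indicators. As an identity of measures it transfers
both integrability and integrals of complex-valued functions. -/
theorem map_cosetIm :
    (((volume : Measure ℍ).restrict 𝒟).prod Measure.count).map cosetIm = imMeasure := by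
  ext S hS
  rw [Measure.map_apply measurable_cosetIm hS, imMeasure, withDensity_apply _ hS,
    ← lintegral_indicator_one (measurable_cosetIm hS),
    lintegral_prod_symm _ (measurable_one.indicator (measurable_cosetIm hS)).aemeasurable,
    lintegral_count]
  have h := tsum_lintegral_fd_im (f := S.indicator 1) (measurable_one.indicator hS)
  refine Eq.trans ?_ (h.trans ?_)
  · rfl
  · rw [← lintegral_indicator hS]
    refine lintegral_congr fun y => ?_
    by_cases hy : y ∈ S <;> simp [hy]

theorem integrableOn_imMeasure_iff {f : ℝ → ℂ} {S : Set ℝ} (hS : MeasurableSet S) :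
    IntegrableOn f S imMeasure ↔
      IntegrableOn (fun y => ((y ^ 2)⁻¹ : ℝ) • f y) (S ∩ Set.Ioi 0) := by
  rw [IntegrableOn, imMeasure, restrict_withDensity hS, Measure.restrict_restrict hS,
    integrable_withDensity_iff_integrable_smul' (by fun_prop) (by simp)]
  refine integrable_congr (Filter.Eventually.of_forall fun y => ?_)
  simp only
  rw [ENNReal.toReal_ofReal (by positivity)]

theorem setIntegral_imMeasure (f : ℝ → ℂ) {S : Set ℝ} (hS : MeasurableSet S) :
    ∫ y in S, f y ∂imMeasure = ∫ y in S ∩ Set.Ioi 0, ((y ^ 2)⁻¹ : ℝ) • f y := by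
  rw [imMeasure, restrict_withDensity hS, Measure.restrict_restrict hS,
    integral_withDensity_eq_integral_toReal_smul (by fun_prop) (by simp)]
  refine integral_congr_ae (Filter.Eventually.of_forall fun y => ?_)
  simp only
  rw [ENNReal.toReal_ofReal (by positivity)]

theorem inv_sq_smul_cpow {y : ℝ} (hy : 0 < y) (s : ℂ) :
    ((y ^ 2)⁻¹ : ℝ) • (y : ℂ) ^ s = (y : ℂ) ^ (s - 2) := by
  have hy' : (y : ℂ) ≠ 0 := by exact_mod_cast hy.ne'
  rw [Complex.cpow_sub _ _ hy', Complex.real_smul]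
  push_cast
  rw [div_eq_mul_inv, mul_comm]
  norm_cast

theorem Iic_inter_Ioi_zero (T : ℝ) : Set.Iic T ∩ Set.Ioi 0 = Set.Ioc 0 T := by
  ext y; simp [and_comm]

theorem integrableOn_cpow_imMeasure {s : ℂ} (hs : 1 < s.re) {T : ℝ} (hT : 1 ≤ T) :
    IntegrableOn (fun y : ℝ => (y : ℂ) ^ s) (Set.Iic T) imMeasure := by
  rw [integrableOn_imMeasure_iff measurableSet_Iic, Iic_inter_Ioi_zero]
  refine IntegrableOn.congr_fun (f := fun y : ℝ => (y : ℂ) ^ (s - 2)) ?_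
    (fun y hy => (inv_sq_smul_cpow hy.1 s).symm) measurableSet_Ioc
  rw [← intervalIntegrable_iff_integrableOn_Ioc_of_le (by linarith)]
  exact intervalIntegral.intervalIntegrable_cpow' (by simp; linarith)

theorem setIntegral_cpow_imMeasure {s : ℂ} (hs : 1 < s.re) {T : ℝ} (hT : 1 ≤ T) :
    ∫ y in Set.Iic T, (y : ℂ) ^ s ∂imMeasure = (T : ℂ) ^ (s - 1) / (s - 1) := by
  rw [setIntegral_imMeasure _ measurableSet_Iic, Iic_inter_Ioi_zero,
    setIntegral_congr_fun measurableSet_Ioc fun y hy => inv_sq_smul_cpow hy.1 s,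
    ← intervalIntegral.integral_of_le (by linarith),
    integral_cpow (Or.inl (by simp; linarith))]
  have h1 : s - 2 + 1 = s - 1 := by ring
  have h2 : s - 1 ≠ 0 := fun h => by
    have := congrArg Complex.re h
    simp at this
    linarith
  rw [h1, Complex.ofReal_zero, Complex.zero_cpow h2, sub_zero]

/-! ### Heights of translates and the truncated unfolding identity -/

theorem im_smul_eq_div (γ : SL(2, ℤ)) (z : ℍ) :
    (γ • z).im = z.im / Complex.normSq ((γ 1 0 : ℤ) * (z : ℂ) + (γ 1 1 : ℤ)) := by
  rw [ModularGroup.im_smul_eq_div_normSq, ModularGroup.denom_apply]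

theorem normSq_linear (m n : ℝ) (z : ℍ) :
    Complex.normSq (m * (z : ℂ) + n) = (m * z.re + n) ^ 2 + m ^ 2 * z.im ^ 2 := by
  rw [Complex.normSq_apply]
  simp
  ring

/-- On `𝒟` one has `|m z + n| ^ 2 ≥ m ^ 2 - |m n| + n ^ 2`, and the right side is a positive
integer. -/
theorem one_le_normSq_linear {z : ℍ} (hz : z ∈ (𝒟 : Set ℍ)) {m n : ℤ} (h : m ≠ 0 ∨ n ≠ 0) :
    1 ≤ Complex.normSq ((m : ℂ) * (z : ℂ) + n) := by
  have e := normSq_linear m n z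
  push_cast at e
  rw [e]
  have h1 : (1 : ℝ) ≤ z.re ^ 2 + z.im ^ 2 := by
    have := hz.1
    rw [Complex.normSq_apply] at this
    change 1 ≤ z.re * z.re + z.im * z.im at this
    linarith
  have h2 : |z.re| ≤ 1 / 2 := hz.2
  have h3 : |2 * (m * n) * z.re| ≤ |(m : ℝ) * n| := by
    rw [abs_mul, abs_mul, abs_two]
    nlinarith [abs_nonneg ((m : ℝ) * n)]
  have h4 : (1 : ℝ) ≤ (m : ℝ) ^ 2 - |(m : ℝ) * n| + (n : ℝ) ^ 2 := by
    have : (1 : ℤ) ≤ m ^ 2 - |m * n| + n ^ 2 := by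
      rcases abs_choice (m * n) with h' | h' <;> rw [h'] <;> rcases h with h | h <;>
        have := Int.one_le_abs h
      all_goals
        by_contra hc
        push Not at hc
        have hm2 : 0 < m ^ 2 + n ^ 2 := by positivity
        nlinarith [sq_nonneg (m - n), sq_nonneg (m + n)]
    exact_mod_cast this
  nlinarith [abs_le.1 h3, sq_nonneg (m : ℝ)]

theorem im_smul_le_one {z : ℍ} (hz : z ∈ (𝒟 : Set ℍ)) {γ : SL(2, ℤ)} (hγ : γ ∉ GammaInf) :
    (γ • z).im ≤ 1 := by
  have hc : γ 1 0 ≠ 0 := hγ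
  have h1 := one_le_normSq_linear hz (m := γ 1 0) (n := γ 1 1) (Or.inl hc)
  rw [im_smul_eq_div, div_le_one (by linarith)]
  -- With bottom row `(c, d)`: below height `1` the bound `|c z + d| ≥ 1` suffices; above it, `|c z
  -- + d| ^ 2 ≥ c ^ 2 y ^ 2 ≥ y`.
  rcases le_total z.im 1 with hy | hy
  · exact hy.trans h1
  · have e := normSq_linear (γ 1 0) (γ 1 1) z
    push_cast at e
    rw [e]
    have : (1 : ℝ) ≤ ((γ 1 0 : ℤ) : ℝ) ^ 2 := by
      exact_mod_cast Int.add_one_le_iff.2 (by positivity : (0 : ℤ) < (γ 1 0) ^ 2)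
    nlinarith [sq_nonneg ((γ 1 0 : ℤ) * z.re + (γ 1 1 : ℤ))]

/-- The part of the fundamental domain above height `T`. -/
def cuspDomain (T : ℝ) : Set ℍ := {z | z ∈ (𝒟 : Set ℍ) ∧ T < z.im}

/-- The cosets different from `Γ_∞`. -/
def bigCosets : Set Cosets := {c | c.out ∉ GammaInf}

theorem measurableSet_cuspDomain (T : ℝ) : MeasurableSet (cuspDomain T) :=
  measurableSet_fd.inter (continuous_im.measurable measurableSet_Ioi)

theorem fd_inter_cosetIm_le {T : ℝ} (hT : 1 ≤ T) :
    cosetIm ⁻¹' Set.Iic T ∩ (𝒟 : Set ℍ) ×ˢ Set.univ =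
      truncatedDomain T ×ˢ Set.univ ∪ cuspDomain T ×ˢ bigCosets := by
  ext ⟨z, c⟩
  by_cases hz : z ∈ (𝒟 : Set ℍ)
  · by_cases hc : c.out ∈ GammaInf
    · have : cosetIm (z, c) = z.im := im_smul_of_mem_GammaInf hc z
      simp [this, hz, truncatedDomain, cuspDomain, bigCosets, hc]
    · have : cosetIm (z, c) ≤ T := (im_smul_le_one hz hc).trans hT
      simp [this, hz, truncatedDomain, cuspDomain, bigCosets, hc, le_or_gt]
  · simp [hz, truncatedDomain, cuspDomain]

/-- Cutting off the image height at `T` leaves `y ^ (s - 2)` on `(0, T]`, integrable because `Re s >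
1`. Integrability of both pieces is inherited from this single integral. -/
theorem unfolding {s : ℂ} (hs : 1 < s.re) {T : ℝ} (hT : 1 ≤ T) :
    IntegrableOn (fun p => (cosetIm p : ℂ) ^ s) (truncatedDomain T ×ˢ Set.univ)
      ((volume : Measure ℍ).prod Measure.count) ∧
    IntegrableOn (fun p => (cosetIm p : ℂ) ^ s) (cuspDomain T ×ˢ bigCosets)
      ((volume : Measure ℍ).prod Measure.count) ∧
    (∫ p in truncatedDomain T ×ˢ Set.univ, (cosetIm p : ℂ) ^ s
      ∂((volume : Measure ℍ).prod Measure.count)) +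
      ∫ p in cuspDomain T ×ˢ bigCosets, (cosetIm p : ℂ) ^ s
      ∂((volume : Measure ℍ).prod Measure.count) = (T : ℂ) ^ (s - 1) / (s - 1) := by
  have hres : ((volume : Measure ℍ).restrict 𝒟).prod Measure.count =
      ((volume : Measure ℍ).prod (Measure.count : Measure Cosets)).restrict
        ((𝒟 : Set ℍ) ×ˢ Set.univ) := by
    rw [← Measure.prod_restrict, Measure.restrict_univ]
  have hsm : AEStronglyMeasurable (fun y : ℝ => (y : ℂ) ^ s)
      ((((volume : Measure ℍ).restrict 𝒟).prod Measure.count).map cosetIm) :=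
    Measurable.aestronglyMeasurable (by fun_prop)
  have hu := measurable_cosetIm
  have hpre : MeasurableSet (cosetIm ⁻¹' Set.Iic T) := hu measurableSet_Iic
  have hint : IntegrableOn (fun p => (cosetIm p : ℂ) ^ s)
      (truncatedDomain T ×ˢ Set.univ ∪ cuspDomain T ×ˢ bigCosets)
      ((volume : Measure ℍ).prod Measure.count) := by
    have h := integrableOn_cpow_imMeasure hs hT
    rw [← map_cosetIm, IntegrableOn, Measure.restrict_map hu measurableSet_Iic] at h
    have h' := h.comp_measurable hu
    rwa [hres, Measure.restrict_restrict hpre, fd_inter_cosetIm_le hT] at h'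
  have hval := setIntegral_cpow_imMeasure hs hT
  rw [← map_cosetIm, setIntegral_map measurableSet_Iic hsm hu.aemeasurable, hres,
    Measure.restrict_restrict hpre, fd_inter_cosetIm_le hT,
    setIntegral_union _ ((measurableSet_cuspDomain T).prod (MeasurableSet.of_discrete))
      hint.left_of_union hint.right_of_union] at hval
  · exact ⟨hint.left_of_union, hint.right_of_union, hval⟩
  · rw [Set.disjoint_left]
    rintro ⟨z, c⟩ h1 h2
    exact absurd h1.1.2 (not_le.2 h2.1.2)

theorem setIntegral_prod_count {α ι : Type*} [MeasurableSpace α] [Countable ι]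
    [MeasurableSpace ι] [DiscreteMeasurableSpace ι] {μ : Measure α} [SFinite μ] {F : α × ι → ℂ}
    {A : Set α} {B : Set ι} (hF : IntegrableOn F (A ×ˢ B) (μ.prod Measure.count)) :
    IntegrableOn (fun a => ∑' i : B, F (a, i)) A μ ∧
      ∫ a in A, ∑' i : B, F (a, i) ∂μ = ∫ p in A ×ˢ B, F p ∂(μ.prod Measure.count) := by
  have hB : MeasurableSet B := .of_discrete
  have h : (fun a => ∫ i in B, F (a, i) ∂Measure.count) =ᵐ[μ.restrict A]
      fun a => ∑' i : B, F (a, i) := by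
    have hF' := hF
    rw [IntegrableOn, ← Measure.prod_restrict] at hF'
    filter_upwards [hF'.prod_right_ae] with a ha
    rw [← integral_indicator hB, integral_countable ((integrable_indicator_iff hB).2 ha),
      tsum_subtype B fun i => F (a, i)]
    simp
  refine ⟨?_, by rw [setIntegral_prod F hF, integral_congr_ae h]⟩
  rw [IntegrableOn, ← Measure.prod_restrict] at hF
  exact hF.integral_prod_left.congr h

/-! ### Sums over integer pairs versus sums over cosets -/

/-- The value of `y / |m z + n| ^ 2` at a pair of integers. -/
noncomputable def quad (z : ℍ) (v : ℤ × ℤ) : ℝ :=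
  z.im / Complex.normSq ((v.1 : ℂ) * (z : ℂ) + v.2)

theorem quad_eq (z : ℍ) (v : ℤ × ℤ) :
    quad z v = z.im / ((v.1 * z.re + v.2) ^ 2 + (v.1 : ℝ) ^ 2 * z.im ^ 2) := by
  rw [quad, ← normSq_linear]
  push_cast
  rfl

theorem quad_nonneg (z : ℍ) (v : ℤ × ℤ) : 0 ≤ quad z v :=
  div_nonneg z.im_pos.le (Complex.normSq_nonneg _)

theorem quad_zero (z : ℍ) : quad z 0 = 0 := by simp [quad]

theorem quad_pos (z : ℍ) {v : ℤ × ℤ} (hv : v ≠ 0) : 0 < quad z v := by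
  rw [quad_eq]
  refine div_pos z.im_pos ?_
  have hy := z.im_pos
  by_cases h : v.1 = 0
  · have h2 : (v.2 : ℝ) ≠ 0 := by
      intro h2
      exact hv (Prod.ext h (by exact_mod_cast h2))
    rw [h]
    simp only [Int.cast_zero, zero_mul, zero_add, ne_eq, OfNat.ofNat_ne_zero, not_false_eq_true,
      zero_pow, add_zero]
    positivity
  · have h1 : (v.1 : ℝ) ≠ 0 := by exact_mod_cast h
    positivity

theorem summable_quad_rpow (z : ℍ) {σ : ℝ} (hσ : 1 < σ) :
    Summable fun v : ℤ × ℤ => quad z v ^ σ := by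
  have h := (EisensteinSeries.summable_one_div_norm_rpow (k := 2 * σ) (by linarith)).mul_left
    (z.im ^ σ * EisensteinSeries.r z ^ (-(2 * σ)))
  have h' := (finTwoArrowEquiv ℤ).symm.summable_iff.2 h
  refine Summable.of_nonneg_of_le (fun v => Real.rpow_nonneg (quad_nonneg z v) σ) (fun v => ?_) h'
  have hb := EisensteinSeries.summand_bound z (k := 2 * σ) (by linarith)
    ((finTwoArrowEquiv ℤ).symm v)
  have e : quad z v ^ σ = z.im ^ σ * ‖(v.1 : ℂ) * (z : ℂ) + v.2‖ ^ (-(2 * σ)) := by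
    rw [quad, Real.div_rpow z.im_pos.le (Complex.normSq_nonneg _), Complex.normSq_eq_norm_sq,
      ← Real.rpow_natCast, ← Real.rpow_mul (norm_nonneg _), Real.rpow_neg (norm_nonneg _)]
    rfl
  rw [e, Function.comp_apply, mul_assoc]
  exact mul_le_mul_of_nonneg_left hb (Real.rpow_nonneg z.im_pos.le σ)

/-- The nonzero integers. -/
abbrev NonzeroInt : Type := {k : ℤ // k ≠ 0}

/-- The integer pair `k (c, d)`, where `(c, d)` is the bottom row of a coset representative. -/
noncomputable def rowPair (p : NonzeroInt × Cosets) : ℤ × ℤ :=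
  (p.1 * p.2.out 1 0, p.1 * p.2.out 1 1)

/-- The lower left entry of `b a⁻¹` is, up to sign, the determinant of the two bottom rows. -/
theorem coset_eq_of_row {a b : SL(2, ℤ)} {k : ℤ} (h0 : b 1 0 = k * a 1 0) (h1 : b 1 1 = k * a 1 1) :
    (Quotient.mk _ a : Cosets) = Quotient.mk _ b := by
  refine Quotient.sound (QuotientGroup.rightRel_apply.mpr ?_)
  change (b.1 * (a⁻¹).1) 1 0 = 0
  rw [Matrix.mul_apply, Fin.sum_univ_two, Matrix.SpecialLinearGroup.SL2_inv_expl]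
  have h0' : b.1 1 0 = k * a.1 1 0 := h0
  have h1' : b.1 1 1 = k * a.1 1 1 := h1
  change b.1 1 0 * a.1 1 1 + b.1 1 1 * -a.1 1 0 = 0
  rw [h0', h1']
  ring

theorem rowPair_injective : Function.Injective rowPair := by
  rintro ⟨⟨k, hk⟩, c⟩ ⟨⟨l, hl⟩, d⟩ h
  have h0 : k * c.out 1 0 = l * d.out 1 0 := congrArg Prod.fst h
  have h1 : k * c.out 1 1 = l * d.out 1 1 := congrArg Prod.snd h
  have hkl : k ∣ l := by
    -- Bézout for the row of `d` writes `l` as a combination of the entries of `l` times that row,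
    -- all divisible by `k`.
    obtain ⟨x, y, hxy⟩ := ModularGroup.bottom_row_coprime d.out
    refine ⟨x * c.out 1 0 + y * c.out 1 1, ?_⟩
    linear_combination (-l) * hxy - x * h0 - y * h1
  obtain ⟨m, rfl⟩ := hkl
  have e0 : c.out 1 0 = m * d.out 1 0 := mul_left_cancel₀ hk (by linear_combination h0)
  have e1 : c.out 1 1 = m * d.out 1 1 := mul_left_cancel₀ hk (by linear_combination h1)
  have hcd := coset_eq_of_row e0 e1
  rw [d.out_eq, c.out_eq] at hcd
  subst hcd
  have hm : m = 1 := by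
    obtain ⟨x, y, hxy⟩ := ModularGroup.bottom_row_coprime d.out
    linear_combination (1 - m) * hxy - x * e0 - y * e1
  subst hm
  simp

/-- Divide by the gcd and complete the coprime pair to a matrix `γ`. The chosen representative of
its coset has the same bottom row up to a unit `g 1 1`, which is absorbed into the multiplier. -/
theorem exists_rowPair {v : ℤ × ℤ} (hv : v ≠ 0) : ∃ p, rowPair p = v := by
  obtain ⟨m, n⟩ := v
  have hg : 0 < m.gcd n := by
    rw [Int.gcd_pos_iff]
    by_contra! hc
    exact hv (Prod.ext hc.1 hc.2)
  obtain ⟨m', n', h, hm, hn⟩ := Int.exists_gcd_one hg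
  obtain ⟨γ, -, hγ⟩ := ModularGroup.bottom_row_surj (R := ℤ)
    (show ![m', n'] ∈ {cd : Fin 2 → ℤ | IsCoprime (cd 0) (cd 1)} from
      Int.isCoprime_iff_gcd_eq_one.2 h)
  have r0 : γ 1 0 = m' := congrFun hγ 0
  have r1 : γ 1 1 = n' := congrFun hγ 1
  set c : Cosets := Quotient.mk _ γ with hc
  have hrel : (QuotientGroup.rightRel GammaInf) c.out γ := Quotient.mk_out γ
  have hmem : γ * (c.out)⁻¹ ∈ GammaInf := QuotientGroup.rightRel_apply.mp hrel
  have hprod : γ = (γ * (c.out)⁻¹) * c.out := by rw [inv_mul_cancel_right]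
  set g := γ * (c.out)⁻¹ with hgdef
  have g10 : g 1 0 = 0 := hmem
  have e : ∀ j, γ 1 j = g 1 1 * c.out 1 j := by
    intro j
    conv_lhs => rw [hprod]
    rw [Matrix.SpecialLinearGroup.coe_mul, Matrix.mul_apply, Fin.sum_univ_two, g10]
    ring
  have hg11 : g 1 1 ≠ 0 := by
    have hdet := g.det_coe
    rw [Matrix.det_fin_two, g10, mul_zero, sub_zero] at hdet
    intro h0
    rw [h0] at hdet
    simp at hdet
  refine ⟨(⟨(m.gcd n : ℤ) * g 1 1, mul_ne_zero (by exact_mod_cast hg.ne') hg11⟩, c), ?_⟩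
  refine Prod.ext ?_ ?_
  · change (m.gcd n : ℤ) * g 1 1 * c.out 1 0 = m
    rw [mul_assoc, ← e, r0, mul_comm]
    exact hm.symm
  · change (m.gcd n : ℤ) * g 1 1 * c.out 1 1 = n
    rw [mul_assoc, ← e, r1, mul_comm]
    exact hn.symm

theorem quad_rowPair (z : ℍ) (p : NonzeroInt × Cosets) :
    quad z (rowPair p) = ((p.1.1.natAbs : ℝ) ^ 2)⁻¹ * cosetIm (z, p.2) := by
  have hk : ((p.1.1.natAbs : ℝ)) ^ 2 = (p.1.1 : ℝ) ^ 2 := by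
    rw [Nat.cast_natAbs, Int.cast_abs, sq_abs]
  rw [cosetIm, im_smul_eq_div, hk, quad, rowPair]
  have : (((p.1.1 * p.2.out 1 0 : ℤ) : ℂ) * (z : ℂ) + ((p.1.1 * p.2.out 1 1 : ℤ) : ℂ)) =
      ((p.1.1 : ℝ) : ℂ) * ((p.2.out 1 0 : ℤ) * (z : ℂ) + (p.2.out 1 1 : ℤ)) := by
    push_cast; ring
  simp only [this, Complex.normSq_mul, Complex.normSq_ofReal]
  rw [← sq, div_mul_eq_div_div_swap, div_eq_mul_inv _ ((p.1.1 : ℝ) ^ 2), mul_comm]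

theorem summable_cosetIm_rpow (z : ℍ) {σ : ℝ} (hσ : 1 < σ) :
    Summable fun c : Cosets => cosetIm (z, c) ^ σ := by
  have hinj : Function.Injective fun c : Cosets => rowPair (⟨1, one_ne_zero⟩, c) := by
    intro c d h
    exact congrArg Prod.snd (rowPair_injective h)
  refine ((summable_quad_rpow z hσ).comp_injective hinj).congr fun c => ?_
  simp [quad_rowPair]

theorem norm_ofReal_cpow {x : ℝ} (hx : 0 ≤ x) {s : ℂ} (hs : 0 < s.re) :
    ‖(x : ℂ) ^ s‖ = x ^ s.re :=
  Complex.norm_cpow_eq_rpow_re_of_nonneg hx hs.ne'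

theorem summable_cosetIm_cpow (z : ℍ) {s : ℂ} (hs : 1 < s.re) :
    Summable fun c : Cosets => ‖(cosetIm (z, c) : ℂ) ^ s‖ := by
  refine (summable_cosetIm_rpow z hs).congr fun c => ?_
  rw [norm_ofReal_cpow (cosetIm_pos _).le (by linarith)]

theorem summable_eisensteinTerm (z : ℍ) {s : ℂ} (hs : 1 < s.re) :
    Summable (eisensteinTerm z s) := by
  refine (summable_cosetIm_cpow z hs).of_norm.congr fun c => ?_
  rw [eisensteinTerm_eq]

/-- The nonnegative and the negative integers contribute `ζ(w)` each; the term at `0` vanishes since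
`0 ^ w = 0` and `1 / 0 = 0`. -/
theorem hasSum_natAbs_cpow {w : ℂ} (hw : 1 < w.re) :
    HasSum (fun k : ℤ => 1 / (k.natAbs : ℂ) ^ w) (2 * riemannZeta w) := by
  have hsum := Complex.summable_one_div_nat_cpow.2 hw
  rw [two_mul]
  refine HasSum.of_nat_of_neg_add_one ?_ ?_
  · rw [zeta_eq_tsum_one_div_nat_cpow hw]
    exact hsum.hasSum
  · rw [zeta_eq_tsum_one_div_nat_add_one_cpow hw]
    have h := ((summable_nat_add_iff 1).2 hsum).hasSum
    have e : ∀ n : ℕ, (-((n : ℤ) + 1)).natAbs = n + 1 := fun n => by omega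
    simp only [e]
    simpa using h

theorem summable_natAbs_cpow {w : ℂ} (hw : 1 < w.re) :
    Summable fun k : NonzeroInt => ‖1 / (k.1.natAbs : ℂ) ^ w‖ :=
  (hasSum_natAbs_cpow hw).summable.norm.comp_injective Subtype.val_injective

theorem tsum_natAbs_cpow {w : ℂ} (hw : 1 < w.re) :
    ∑' k : NonzeroInt, 1 / (k.1.natAbs : ℂ) ^ w = 2 * riemannZeta w := by
  rw [← (hasSum_natAbs_cpow hw).tsum_eq]
  refine Subtype.val_injective.tsum_eq (f := fun k : ℤ => 1 / (k.natAbs : ℂ) ^ w) fun k hk => ?_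
  refine ⟨⟨k, fun h => hk ?_⟩, rfl⟩
  have hw0 : w ≠ 0 := fun h => by simp [h] at hw; linarith
  simp [h, Complex.zero_cpow hw0]

theorem quad_rowPair_cpow (z : ℍ) (s : ℂ) (p : NonzeroInt × Cosets) :
    (quad z (rowPair p) : ℂ) ^ s =
      1 / (p.1.1.natAbs : ℂ) ^ (2 * s) * (cosetIm (z, p.2) : ℂ) ^ s := by
  have hk : (0 : ℝ) < p.1.1.natAbs := by
    exact_mod_cast Int.natAbs_pos.2 p.1.2
  rw [quad_rowPair]
  generalize p.1.1.natAbs = n at hk ⊢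
  rw [Complex.ofReal_mul, Complex.mul_cpow_ofReal_nonneg (by positivity)
    (cosetIm_pos _).le]
  congr 1
  rw [Complex.ofReal_inv, Complex.inv_cpow _ _ (by
      rw [Complex.arg_ofReal_of_nonneg (by positivity)]; exact Real.pi_pos.ne),
    Complex.ofReal_pow, one_div, ← Complex.cpow_nat_mul' (by
      simp [Complex.natCast_arg, Real.pi_pos]) (by
      simp [Complex.natCast_arg, Real.pi_pos.le])]
  simp

theorem tsum_quad_cpow (z : ℍ) {s : ℂ} (hs : 1 < s.re) :
    ∑' v : ℤ × ℤ, (quad z v : ℂ) ^ s =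
      2 * riemannZeta (2 * s) * ∑' c : Cosets, (cosetIm (z, c) : ℂ) ^ s := by
  have hw : 1 < (2 * s).re := by simp; linarith
  have hs0 : s ≠ 0 := fun h => by simp [h] at hs; linarith
  rw [← tsum_natAbs_cpow hw, tsum_mul_tsum_of_summable_norm (summable_natAbs_cpow hw)
    (summable_cosetIm_cpow z hs), ← rowPair_injective.tsum_eq]
  · exact tsum_congr fun p => quad_rowPair_cpow z s p
  -- The pair `0` is missed by `rowPair`, but there `quad` is `0` by division by zero, and `0 ^ s =
  -- 0`.
  · intro v hv
    refine exists_rowPair fun h => hv ?_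
    simp [h, quad_zero, Complex.zero_cpow hs0]

theorem fst_rowPair_ne_zero (p : NonzeroInt × bigCosets) : (rowPair (p.1, p.2)).1 ≠ 0 :=
  mul_ne_zero p.1.2 p.2.2

/-- The pairs with nonzero first entry are exactly the multiples of bottom rows of nontrivial
cosets, so the bijection of `tsum_quad_cpow` restricts. -/
theorem tsum_quad_big (z : ℍ) {s : ℂ} (hs : 1 < s.re) :
    ∑' v : NonzeroInt × ℤ, (quad z (v.1, v.2) : ℂ) ^ s =
      2 * riemannZeta (2 * s) * ∑' c : bigCosets, (cosetIm (z, c) : ℂ) ^ s := by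
  have hw : 1 < (2 * s).re := by simp; linarith
  have hsum : Summable fun c : bigCosets => ‖(cosetIm (z, c) : ℂ) ^ s‖ :=
    (summable_cosetIm_cpow z hs).comp_injective Subtype.val_injective
  rw [← tsum_natAbs_cpow hw, tsum_mul_tsum_of_summable_norm (summable_natAbs_cpow hw) hsum]
  let ψ : NonzeroInt × bigCosets → NonzeroInt × ℤ := fun p =>
    (⟨(rowPair (p.1, p.2)).1, fst_rowPair_ne_zero p⟩, (rowPair (p.1, p.2)).2)
  have hψ : Function.Bijective ψ := by
    constructor
    · intro p q h
      have h1 : (rowPair (p.1, p.2)).1 = (rowPair (q.1, q.2)).1 :=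
        congrArg (fun r : NonzeroInt × ℤ => r.1.1) h
      have h2 : (rowPair (p.1, p.2)).2 = (rowPair (q.1, q.2)).2 :=
        congrArg (fun r : NonzeroInt × ℤ => r.2) h
      have := rowPair_injective (Prod.ext h1 h2)
      exact Prod.ext (congrArg (fun r : NonzeroInt × Cosets => r.1) this)
        (Subtype.ext (congrArg (fun r : NonzeroInt × Cosets => r.2) this))
    · rintro ⟨⟨m, hm⟩, n⟩
      obtain ⟨⟨k, c⟩, hp⟩ := exists_rowPair (v := (m, n)) fun h => hm (congrArg Prod.fst h)
      have hc : c ∈ bigCosets := by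
        intro hc
        have hc' : c.out 1 0 = 0 := hc
        have : k.1 * c.out 1 0 = m := congrArg Prod.fst hp
        rw [hc', mul_zero] at this
        exact hm this.symm
      refine ⟨(k, ⟨c, hc⟩), Prod.ext (Subtype.ext ?_) ?_⟩
      · exact (congrArg Prod.fst hp : (rowPair (k, c)).1 = m)
      · exact (congrArg Prod.snd hp : (rowPair (k, c)).2 = n)
  rw [← (Equiv.ofBijective ψ hψ).tsum_eq]
  exact tsum_congr fun p => quad_rowPair_cpow z s (p.1, p.2)

/-! ### Unrolling the cusp and separating variables -/

theorem setLIntegral_tsum_add_int {h : ℝ → ENNReal} (hh : Measurable h) (a : ℝ) :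
    ∫⁻ x in Set.Ioc a (a + 1), ∑' q : ℤ, h (x + q) = ∫⁻ x, h x := by
  rw [lintegral_tsum fun q => by fun_prop, ← setLIntegral_univ h, ← iUnion_Ioc_add_intCast a,
    lintegral_iUnion (fun _ => measurableSet_Ioc) (Set.pairwise_disjoint_Ioc_add_intCast a)]
  refine tsum_congr fun q => ?_
  rw [← (measurePreserving_add_right volume (q : ℝ)).setLIntegral_comp_preimage
    measurableSet_Ioc hh]
  congr 3
  ext x
  simp only [Set.mem_preimage, Set.mem_Ioc]
  constructor <;> rintro ⟨h1, h2⟩ <;> constructor <;> linarith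

theorem lintegral_comp_mul_add {k : ℝ → ENNReal} (hk : Measurable k) {a : ℝ} (ha : a ≠ 0) (b : ℝ) :
    ∫⁻ x, k (a * x + b) = ENNReal.ofReal |a⁻¹| * ∫⁻ x, k x := by
  have hkb : Measurable fun x => k (x + b) := by fun_prop
  have h := lintegral_map (μ := volume) hkb (measurable_const_mul a)
  rw [Real.map_volume_mul_left ha, lintegral_smul_measure, lintegral_add_right_eq_self] at h
  exact h.symm

/-- Write `n = q m + r`. For fixed `r`, summing over `q` unrolls the unit interval to the line and
gives `1 / m` times the integral of `k`; there are `m` residues. -/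
theorem setLIntegral_tsum_nat_mul_add {k : ℝ → ENNReal} (hk : Measurable k) (m : ℕ) [NeZero m]
    (a : ℝ) :
    ∫⁻ x in Set.Ioc a (a + 1), ∑' n : ℤ, k (m * x + n) = ∫⁻ x, k x := by
  have hm : (m : ℝ) ≠ 0 := by exact_mod_cast NeZero.ne m
  have h1 : ∀ x : ℝ, ∑' n : ℤ, k (m * x + n) =
      ∑' r : Fin m, ∑' q : ℤ, k (m * (x + q) + (r : ℕ)) := by
    intro x
    rw [ENNReal.tsum_comm, ← (Int.divModEquiv m).symm.tsum_eq, ← ENNReal.tsum_prod]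
    refine tsum_congr fun p => ?_
    congr 1
    change (m : ℝ) * x + ((p.1 * m + (p.2 : ℕ) : ℤ) : ℝ) = _
    push_cast
    ring
  simp_rw [h1]
  rw [lintegral_tsum fun r => (Measurable.tsum fun q => by fun_prop).aemeasurable]
  have h2 : ∀ r : Fin m, ∫⁻ x in Set.Ioc a (a + 1), ∑' q : ℤ, k (m * (x + q) + (r : ℕ)) =
      ENNReal.ofReal |(m : ℝ)⁻¹| * ∫⁻ x, k x := by
    intro r
    rw [setLIntegral_tsum_add_int (h := fun x => k (m * x + (r : ℕ))) (by fun_prop),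
      lintegral_comp_mul_add hk hm]
  simp_rw [h2]
  rw [tsum_fintype, Finset.sum_const, Finset.card_univ, Fintype.card_fin, nsmul_eq_mul,
    ← mul_assoc, abs_of_nonneg (by positivity), ← ENNReal.ofReal_natCast,
    ← ENNReal.ofReal_mul (by positivity), mul_inv_cancel₀ hm, ENNReal.ofReal_one, one_mul]

theorem setLIntegral_tsum_int_mul_add {k : ℝ → ENNReal} (hk : Measurable k)
    (heven : ∀ x, k (-x) = k x) (m : NonzeroInt) :
    ∫⁻ x in Set.Icc (-(1 / 2) : ℝ) (1 / 2), ∑' n : ℤ, k (m.1 * x + n) = ∫⁻ x, k x := by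
  have : NeZero m.1.natAbs := ⟨Int.natAbs_ne_zero.2 m.2⟩
  rw [setLIntegral_congr Ioc_ae_eq_Icc.symm, ← setLIntegral_tsum_nat_mul_add hk m.1.natAbs
    (-(1 / 2)), show (-(1 / 2) + 1 : ℝ) = 1 / 2 by norm_num]
  refine lintegral_congr fun x => ?_
  rcases Int.natAbs_eq m.1 with h | h
  · have h' : ((m.1 : ℤ) : ℝ) = (m.1.natAbs : ℝ) := by
      conv_lhs => rw [h]
      rw [Int.cast_natCast]
    rw [h']
  · have h' : ((m.1 : ℤ) : ℝ) = -(m.1.natAbs : ℝ) := by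
      conv_lhs => rw [h]
      rw [Int.cast_neg, Int.cast_natCast]
    rw [h', ← (Equiv.neg ℤ).tsum_eq]
    refine tsum_congr fun n => ?_
    rw [← heven]
    congr 1
    simp
    ring

theorem mem_cuspDomain_iff {T : ℝ} (hT : 1 ≤ T) {z : ℍ} :
    z ∈ cuspDomain T ↔ z.re ∈ Set.Icc (-(1 / 2) : ℝ) (1 / 2) ∧ z.im ∈ Set.Ioi T := by
  have e : z ∈ cuspDomain T ↔ (1 ≤ Complex.normSq (z : ℂ) ∧ |z.re| ≤ 1 / 2) ∧ T < z.im := Iff.rfl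
  rw [e, Set.mem_Icc, ← abs_le, Set.mem_Ioi]
  refine ⟨fun h => ⟨h.1.2, h.2⟩, fun h => ⟨⟨?_, h.1⟩, h.2⟩⟩
  rw [Complex.normSq_apply]
  change 1 ≤ z.re * z.re + z.im * z.im
  nlinarith [h.2, mul_self_nonneg z.re]

theorem setLIntegral_cuspDomain {T : ℝ} (hT : 1 ≤ T) {f : ℝ × ℝ → ENNReal} (hf : Measurable f) :
    ∫⁻ z in cuspDomain T, f (z.re, z.im) =
      ∫⁻ y in Set.Ioi T, (∫⁻ x in Set.Icc (-(1 / 2) : ℝ) (1 / 2), f (x, y)) *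
        ENNReal.ofReal (y ^ 2)⁻¹ := by
  have hm : MeasurableSet (Set.Icc (-(1 / 2) : ℝ) (1 / 2) ×ˢ Set.Ioi T) :=
    measurableSet_Icc.prod measurableSet_Ioi
  have h := lintegral_re_im (hf.indicator hm)
  rw [← lintegral_indicator (measurableSet_cuspDomain T)]
  refine Eq.trans (lintegral_congr fun z => ?_) (h.trans ?_)
  · by_cases hz : z ∈ cuspDomain T
    · rw [Set.indicator_of_mem hz, Set.indicator_of_mem (by exact (mem_cuspDomain_iff hT).1 hz)]
    · rw [Set.indicator_of_notMem hz]
      exact (Set.indicator_of_notMem (s := Set.Icc (-(1 / 2) : ℝ) (1 / 2) ×ˢ Set.Ioi T)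
        (a := (z.re, z.im)) (fun h => hz ((mem_cuspDomain_iff hT).2 h)) f).symm
  · rw [← lintegral_indicator measurableSet_Ioi, ← lintegral_indicator measurableSet_Ioi]
    refine lintegral_congr fun y => ?_
    by_cases hy : y ∈ Set.Ioi T
    · have hy0 : y ∈ Set.Ioi (0 : ℝ) := lt_trans (by linarith) (Set.mem_Ioi.1 hy)
      rw [Set.indicator_of_mem hy, Set.indicator_of_mem hy0,
        ← lintegral_indicator measurableSet_Icc]
      congr 1
      refine lintegral_congr fun x => ?_
      by_cases hx : x ∈ Set.Icc (-(1 / 2) : ℝ) (1 / 2)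
      · rw [Set.indicator_of_mem hx]
        exact Set.indicator_of_mem (s := Set.Icc (-(1 / 2) : ℝ) (1 / 2) ×ˢ Set.Ioi T)
          (a := (x, y)) ⟨hx, hy⟩ f
      · rw [Set.indicator_of_notMem hx]
        exact Set.indicator_of_notMem (s := Set.Icc (-(1 / 2) : ℝ) (1 / 2) ×ˢ Set.Ioi T)
          (a := (x, y)) (fun h => hx h.1) f
    · rw [Set.indicator_of_notMem hy]
      have : ∫⁻ x : ℝ, (Set.Icc (-(1 / 2) : ℝ) (1 / 2) ×ˢ Set.Ioi T).indicator f (x, y) = 0 := by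
        refine lintegral_eq_zero_of_ae_eq_zero (Filter.Eventually.of_forall fun x => ?_)
        exact Set.indicator_of_notMem (fun h => hy h.2) _
      by_cases hy0 : y ∈ Set.Ioi (0 : ℝ)
      · rw [Set.indicator_of_mem hy0, this, zero_mul]
      · rw [Set.indicator_of_notMem hy0]

/-- The measure `|m| · (dy / y) · dw` on `(ℤ \ 0) × (T, ∞) × ℝ`. -/
noncomputable def cuspMeasure (T : ℝ) : Measure (NonzeroInt × ℝ × ℝ) :=
  ((Measure.count : Measure NonzeroInt).withDensity fun m => ENNReal.ofReal |(m.1 : ℝ)|).prod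
    ((((volume : Measure ℝ).restrict (Set.Ioi T)).withDensity fun y => ENNReal.ofReal y⁻¹).prod
      volume)

/-- The function `1 / (m ^ 2 |y| (1 + w ^ 2))`. -/
noncomputable def cuspFun (q : NonzeroInt × ℝ × ℝ) : ℝ :=
  ((q.1.1 : ℝ) ^ 2)⁻¹ * (|q.2.1|⁻¹ * (1 + q.2.2 ^ 2)⁻¹)

theorem measurable_cuspFun : Measurable cuspFun :=
  measurable_from_prod_countable_right fun m => by
    unfold cuspFun
    fun_prop

theorem measurable_quad : Measurable fun p : ℍ × (NonzeroInt × ℤ) => quad p.1 (p.2.1, p.2.2) := by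
  refine measurable_from_prod_countable_left fun v => ?_
  simp only [quad_eq]
  have := continuous_re.measurable
  have := continuous_im.measurable
  fun_prop

/-- After unrolling, the variable `u` on the line is replaced by `m y w`, which turns `y / (u ^ 2 +
m ^ 2 y ^ 2)` into `1 / (m ^ 2 y (1 + w ^ 2))`. The Jacobian `|m| y` times `y⁻²` leaves the weight
`|m| y⁻¹`. -/
theorem tsum_lintegral_quad {T : ℝ} (hT : 1 ≤ T) {f : ℝ → ENNReal} (hf : Measurable f) :
    ∑' v : NonzeroInt × ℤ, ∫⁻ z in cuspDomain T, f (quad z (v.1, v.2)) =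
      ∑' m : NonzeroInt, ENNReal.ofReal |(m.1 : ℝ)| *
        ∫⁻ y in Set.Ioi T, ENNReal.ofReal y⁻¹ * ∫⁻ w, f (cuspFun (m, y, w)) := by
  rw [ENNReal.tsum_prod (f := fun (m : NonzeroInt) (n : ℤ) =>
    ∫⁻ z in cuspDomain T, f (quad z (m, n)))]
  refine tsum_congr fun m => ?_
  have hm : (m.1 : ℝ) ≠ 0 := by exact_mod_cast m.2
  have hF : ∀ n : ℤ, Measurable fun q : ℝ × ℝ =>
      f (q.2 / ((m.1 * q.1 + n) ^ 2 + (m.1 : ℝ) ^ 2 * q.2 ^ 2)) := fun n => by fun_prop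
  have h1 : ∀ n : ℤ, ∫⁻ z in cuspDomain T, f (quad z (m, n)) =
      ∫⁻ y in Set.Ioi T, (∫⁻ x in Set.Icc (-(1 / 2) : ℝ) (1 / 2),
        f (y / ((m.1 * x + n) ^ 2 + (m.1 : ℝ) ^ 2 * y ^ 2))) * ENNReal.ofReal (y ^ 2)⁻¹ := by
    intro n
    rw [← setLIntegral_cuspDomain hT (hF n)]
    simp only [quad_eq]
  simp_rw [h1]
  rw [← lintegral_tsum fun n => by
      refine (Measurable.mul ?_ (by fun_prop)).aemeasurable
      exact Measurable.lintegral_prod_left' (hF n),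
    ← lintegral_const_mul' _ _ ENNReal.ofReal_ne_top]
  refine setLIntegral_congr_fun measurableSet_Ioi fun y hy => ?_
  have hy0 : 0 < y := lt_of_lt_of_le (by linarith) (le_of_lt hy)
  rw [ENNReal.tsum_mul_right, ← lintegral_tsum fun n => by fun_prop,
    setLIntegral_tsum_int_mul_add
      (k := fun u => f (y / (u ^ 2 + (m.1 : ℝ) ^ 2 * y ^ 2))) (by fun_prop) (by simp) m]
  have hmy : (m.1 : ℝ) * y ≠ 0 := mul_ne_zero hm hy0.ne'
  have h2 := lintegral_comp_mul_add (k := fun u => f (y / (u ^ 2 + (m.1 : ℝ) ^ 2 * y ^ 2)))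
    (by fun_prop) hmy 0
  have h3 : ∀ w : ℝ, f (y / ((m.1 * y * w + 0) ^ 2 + (m.1 : ℝ) ^ 2 * y ^ 2)) =
      f (cuspFun (m, y, w)) := by
    intro w
    congr 1
    rw [cuspFun, abs_of_pos hy0]
    have : 1 + w ^ 2 ≠ 0 := by positivity
    have : (m.1 * y * w + 0) ^ 2 + (m.1 : ℝ) ^ 2 * y ^ 2 = (m.1 : ℝ) ^ 2 * y ^ 2 * (1 + w ^ 2) := by
      ring
    rw [this]
    field_simp
  simp only [h3] at h2
  have hco : ENNReal.ofReal |(m.1 : ℝ)| * ENNReal.ofReal y⁻¹ *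
      ENNReal.ofReal |((m.1 : ℝ) * y)⁻¹| = ENNReal.ofReal (y ^ 2)⁻¹ := by
    rw [← ENNReal.ofReal_mul (by positivity), ← ENNReal.ofReal_mul (by positivity)]
    congr 1
    have : |(m.1 : ℝ)| ≠ 0 := abs_ne_zero.2 hm
    rw [abs_inv, abs_mul, abs_of_pos hy0]
    field_simp
  rw [h2, ← mul_assoc, ← mul_assoc, hco, mul_comm]

theorem map_quad {T : ℝ} (hT : 1 ≤ T) :
    (((volume : Measure ℍ).restrict (cuspDomain T)).prod
      (Measure.count : Measure (NonzeroInt × ℤ))).map (fun p => quad p.1 (p.2.1, p.2.2)) =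
      (cuspMeasure T).map cuspFun := by
  ext S hS
  have hone : Measurable (S.indicator (1 : ℝ → ENNReal)) := measurable_one.indicator hS
  rw [Measure.map_apply measurable_quad hS, Measure.map_apply measurable_cuspFun hS,
    ← lintegral_indicator_one (measurable_quad hS),
    ← lintegral_indicator_one (measurable_cuspFun hS),
    lintegral_prod_symm _ (measurable_one.indicator (measurable_quad hS)).aemeasurable,
    lintegral_count]
  refine Eq.trans ?_ ((tsum_lintegral_quad hT hone).trans ?_)
  · rfl
  · have hc : Measurable fun q => S.indicator (1 : ℝ → ENNReal) (cuspFun q) :=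
      hone.comp measurable_cuspFun
    change _ = ∫⁻ q, S.indicator (1 : ℝ → ENNReal) (cuspFun q) ∂(cuspMeasure T)
    rw [cuspMeasure, lintegral_prod _ hc.aemeasurable,
      lintegral_withDensity_eq_lintegral_mul _ .of_discrete .of_discrete, lintegral_count]
    refine tsum_congr fun m => ?_
    have hcm : Measurable fun q : ℝ × ℝ => S.indicator (1 : ℝ → ENNReal) (cuspFun (m, q)) :=
      hc.comp (measurable_const.prodMk measurable_id)
    rw [Pi.mul_apply, lintegral_prod _ hcm.aemeasurable,
      lintegral_withDensity_eq_lintegral_mul _ (by fun_prop) hcm.lintegral_prod_right']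
    rfl

/-! ### Gamma integrals and the value of the separated cusp integral -/

theorem integrable_inv_one_add_sq_cpow {s : ℂ} (hs : 1 / 2 < s.re) :
    Integrable fun w : ℝ => (((1 + w ^ 2)⁻¹ : ℝ) : ℂ) ^ s := by
  have h := integrable_rpow_neg_one_add_norm_sq (E := ℝ) (μ := volume) (r := 2 * s.re)
    (by simp; linarith)
  refine h.mono' (Measurable.aestronglyMeasurable (by fun_prop))
    (Filter.Eventually.of_forall fun w => le_of_eq ?_)
  have hp : 0 < 1 + w ^ 2 := by positivity
  rw [norm_ofReal_cpow (by positivity) (by linarith), Real.inv_rpow hp.le,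
    ← Real.rpow_neg hp.le, Real.norm_eq_abs, sq_abs]
  congr 1
  ring

theorem Gamma_mul_inv_cpow {s : ℂ} (hs : 0 < s.re) {r : ℝ} (hr : 0 < r) :
    Complex.Gamma s * ((r⁻¹ : ℝ) : ℂ) ^ s =
      ∫ t in Set.Ioi (0 : ℝ), (t : ℂ) ^ (s - 1) * Complex.exp (-(r * t)) := by
  rw [Complex.integral_cpow_mul_exp_neg_mul_Ioi hs hr, mul_comm]
  push_cast
  rw [one_div]

theorem integrableOn_cpow_mul_exp {s : ℂ} (hs : 0 < s.re) {r : ℝ} (hr : 0 < r) :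
    IntegrableOn (fun t : ℝ => (t : ℂ) ^ (s - 1) * Complex.exp (-(r * t))) (Set.Ioi 0) := by
  have h := integrableOn_rpow_mul_exp_neg_mul_rpow (s := s.re - 1) (p := 1) (b := r)
    (by linarith) one_pos hr
  refine Integrable.mono' h (Measurable.aestronglyMeasurable (by fun_prop)) ?_
  refine (ae_restrict_iff' measurableSet_Ioi).2 (Filter.Eventually.of_forall fun t ht => ?_)
  rw [norm_mul, Complex.norm_cpow_eq_rpow_re_of_pos ht, Complex.norm_exp]
  simp

theorem integral_exp_neg_mul_sq {t : ℝ} (ht : 0 < t) :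
    ∫ w : ℝ, Complex.exp (-(t * (w : ℂ) ^ 2)) = ((Real.pi : ℝ) : ℂ) ^ (1 / 2 : ℂ) *
      (t : ℂ) ^ (-(1 / 2) : ℂ) := by
  have h := integral_gaussian_complex (b := t) (by simpa using ht)
  have e : ∀ w : ℝ, Complex.exp (-(t * (w : ℂ) ^ 2)) = Complex.exp (-(t : ℂ) * (w : ℂ) ^ 2) := by
    intro w; congr 1; ring
  simp_rw [e]
  rw [h, div_eq_mul_inv, ← Complex.ofReal_inv,
    Complex.mul_cpow_ofReal_nonneg Real.pi_pos.le (inv_nonneg.2 ht.le), Complex.ofReal_inv,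
    Complex.inv_cpow _ _ (by rw [Complex.arg_ofReal_of_nonneg ht.le]; exact Real.pi_pos.ne),
    Complex.cpow_neg]

/-- Insert `Γ(s) r ^ (-s) = ∫ t ^ (s - 1) e ^ (-r t) dt` with `r = 1 + w ^ 2` and swap the
integrals. The Gaussian in `w` contributes `π ^ (1/2) t ^ (-1/2)`, which shifts `s` by `1/2`. -/
theorem Gamma_mul_integral_inv_one_add_sq {s : ℂ} (hs : 1 / 2 < s.re) :
    Complex.Gamma s * ∫ w : ℝ, (((1 + w ^ 2)⁻¹ : ℝ) : ℂ) ^ s =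
      ((Real.pi : ℝ) : ℂ) ^ (1 / 2 : ℂ) * Complex.Gamma (s - 1 / 2) := by
  have hs0 : 0 < s.re := by linarith
  have hs' : 0 < (s - 1 / 2).re := by simp; linarith
  set F : ℝ → ℝ → ℂ := fun w t =>
    (t : ℂ) ^ (s - 1) * Complex.exp (-(((1 + w ^ 2 : ℝ) : ℂ) * t)) with hF
  have hFe : ∀ w t, F w t =
      (t : ℂ) ^ (s - 1) * Complex.exp (-(((1 : ℝ) : ℂ) * t)) * Complex.exp (-(t * (w : ℂ) ^ 2)) := by
    intro w t
    rw [hF, mul_assoc, ← Complex.exp_add]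
    push_cast
    ring_nf
  have hFm : Measurable (Function.uncurry F) := by
    unfold Function.uncurry
    simp only [hF]
    fun_prop
  have hgauss : ∀ t : ℝ, 0 < t → Integrable fun w : ℝ => Complex.exp (-(t * (w : ℂ) ^ 2)) := by
    intro t ht
    have h := integrable_cexp_neg_mul_sq (b := t) (by simpa using ht)
    refine h.congr (Filter.Eventually.of_forall fun w => ?_)
    simp only
    congr 1
    ring
  have hcombine : ∀ t : ℝ, 0 < t → (t : ℂ) ^ (s - 1) * Complex.exp (-(((1 : ℝ) : ℂ) * t)) *
      (((Real.pi : ℝ) : ℂ) ^ (1 / 2 : ℂ) * (t : ℂ) ^ (-(1 / 2) : ℂ)) =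
      ((Real.pi : ℝ) : ℂ) ^ (1 / 2 : ℂ) *
        ((t : ℂ) ^ (s - 1 / 2 - 1) * Complex.exp (-(((1 : ℝ) : ℂ) * t))) := by
    intro t ht
    have ht' : (t : ℂ) ≠ 0 := by exact_mod_cast ht.ne'
    rw [show s - 1 / 2 - 1 = (s - 1) + -(1 / 2) by ring, Complex.cpow_add _ _ ht']
    ring
  have hint : Integrable (Function.uncurry F)
      ((volume : Measure ℝ).prod ((volume : Measure ℝ).restrict (Set.Ioi 0))) := by
    rw [integrable_prod_iff' hFm.aestronglyMeasurable]
    constructor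
    · refine (ae_restrict_iff' measurableSet_Ioi).2 (Filter.Eventually.of_forall fun t ht => ?_)
      simp only [Function.uncurry, hFe]
      exact (hgauss t ht).const_mul _
    -- The Gaussian factor is positive, so integrating the norm over `w` gives the norm of the
    -- integral, and this is a Gamma integrand at `s - 1/2`.
    · have h := ((integrableOn_cpow_mul_exp hs' one_pos).const_mul
        (((Real.pi : ℝ) : ℂ) ^ (1 / 2 : ℂ))).norm
      refine Integrable.congr h ?_
      refine (ae_restrict_iff' measurableSet_Ioi).2 (Filter.Eventually.of_forall fun t ht => ?_)
      simp only [Function.uncurry, hFe]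
      rw [← hcombine t ht, ← integral_exp_neg_mul_sq ht]
      simp only [norm_mul]
      rw [integral_const_mul]
      congr 1
      have e : ∀ w : ℝ, Complex.exp (-(t * (w : ℂ) ^ 2)) =
          ((Real.exp (-(t * w ^ 2)) : ℝ) : ℂ) := by intro w; push_cast; rfl
      rw [integral_congr_ae (Filter.Eventually.of_forall e), integral_complex_ofReal, Complex.norm_real, Real.norm_of_nonneg]
      · refine integral_congr_ae (Filter.Eventually.of_forall fun w => ?_)
        simp only
        rw [e, Complex.norm_real, Real.norm_of_nonneg (Real.exp_pos _).le]
      · exact integral_nonneg fun w => (Real.exp_pos _).le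
  have h1 : ∀ w : ℝ, Complex.Gamma s * (((1 + w ^ 2)⁻¹ : ℝ) : ℂ) ^ s =
      ∫ t in Set.Ioi (0 : ℝ), F w t := fun w => Gamma_mul_inv_cpow hs0 (by positivity)
  rw [← integral_const_mul]
  simp_rw [h1]
  rw [integral_integral_swap hint]
  have h2 : ∀ t ∈ Set.Ioi (0 : ℝ), ∫ w : ℝ, F w t = ((Real.pi : ℝ) : ℂ) ^ (1 / 2 : ℂ) *
        ((t : ℂ) ^ (s - 1 / 2 - 1) * Complex.exp (-(((1 : ℝ) : ℂ) * t))) := by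
    intro t ht
    simp_rw [hFe]
    rw [integral_const_mul, integral_exp_neg_mul_sq ht, hcombine t ht]
  rw [setIntegral_congr_fun measurableSet_Ioi h2, integral_const_mul,
    ← Gamma_mul_inv_cpow hs' one_pos]
  simp

theorem completedZeta_eq {w : ℂ} (hw : 1 < w.re) :
    completedRiemannZeta w =
      ((Real.pi : ℝ) : ℂ) ^ (-w / 2) * Complex.Gamma (w / 2) * riemannZeta w := by
  have hw0 : w ≠ 0 := fun h => by simp [h] at hw; linarith
  have hG : w.Gammaℝ ≠ 0 := Complex.Gammaℝ_ne_zero_of_re_pos (by linarith)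
  rw [riemannZeta_def_of_ne_zero hw0, ← Complex.Gammaℝ_def, mul_div_cancel₀ _ hG]

/-- Function and measure are both products: the weight `|m|` turns the sum of `|m| ^ (-2s)` into `2
ζ(2s - 1)`, and `∫_T^∞ y ^ (-s - 1) dy = T ^ (-s) / s`. -/
theorem integrable_cuspFun_cpow {s : ℂ} (hs : 1 < s.re) {T : ℝ} (hT : 1 ≤ T) :
    Integrable (fun q => (cuspFun q : ℂ) ^ s) (cuspMeasure T) ∧
      ∫ q, (cuspFun q : ℂ) ^ s ∂cuspMeasure T =
        2 * riemannZeta (2 * s - 1) *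
          ((T : ℂ) ^ (-s) / s * ∫ w : ℝ, (((1 + w ^ 2)⁻¹ : ℝ) : ℂ) ^ s) := by
  have hT0 : 0 < T := by linarith
  have hs0 : s ≠ 0 := fun h => by simp [h] at hs; linarith
  set f₁ : NonzeroInt → ℂ := fun m => ((((m.1 : ℝ) ^ 2)⁻¹ : ℝ) : ℂ) ^ s
  set f₂ : ℝ → ℂ := fun y => ((|y|⁻¹ : ℝ) : ℂ) ^ s
  set f₃ : ℝ → ℂ := fun w => (((1 + w ^ 2)⁻¹ : ℝ) : ℂ) ^ s
  have hw : 1 < (2 * s - 1).re := by simp; linarith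
  have e₁ : ∀ m : NonzeroInt, (ENNReal.ofReal |(m.1 : ℝ)|).toReal • f₁ m =
      1 / (m.1.natAbs : ℂ) ^ (2 * s - 1) := by
    intro m
    have hn : (0 : ℝ) < (m.1.natAbs : ℝ) := by exact_mod_cast Int.natAbs_pos.2 m.2
    have habs : |(m.1 : ℝ)| = (m.1.natAbs : ℝ) := by rw [Nat.cast_natAbs, Int.cast_abs]
    simp only [f₁]
    rw [ENNReal.toReal_ofReal (abs_nonneg _), ← sq_abs, habs]
    generalize m.1.natAbs = n at hn
    have hn' : (n : ℂ) ≠ 0 := by exact_mod_cast hn.ne'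
    rw [Complex.ofReal_inv, Complex.inv_cpow _ _ (by
      rw [Complex.arg_ofReal_of_nonneg (by positivity)]; exact Real.pi_pos.ne),
    Complex.ofReal_pow, Complex.ofReal_natCast, ← Complex.cpow_nat_mul' (by
      simp [Complex.natCast_arg, Real.pi_pos]) (by
      simp [Complex.natCast_arg, Real.pi_pos.le]), Complex.cpow_sub _ _ hn', Complex.real_smul]
    simp [div_eq_mul_inv]
  have e₂ : ∀ y ∈ Set.Ioi T, (ENNReal.ofReal y⁻¹).toReal • f₂ y = (y : ℂ) ^ (-s - 1) := by
    intro y hy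
    have hy0 : 0 < y := hT0.trans hy
    have hy' : (y : ℂ) ≠ 0 := by exact_mod_cast hy0.ne'
    simp only [f₂]
    rw [abs_of_pos hy0, ENNReal.toReal_ofReal (by positivity), Complex.ofReal_inv, Complex.inv_cpow _ _ (by
      rw [Complex.arg_ofReal_of_nonneg hy0.le]; exact Real.pi_pos.ne),
      Complex.cpow_sub _ _ hy', Complex.cpow_neg, Complex.real_smul, Complex.cpow_one]
    push_cast
    rw [div_eq_mul_inv, mul_comm]
  have hprod : ∀ᵐ q ∂cuspMeasure T, f₁ q.1 * (f₂ q.2.1 * f₃ q.2.2) = (cuspFun q : ℂ) ^ s := by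
    refine Filter.Eventually.of_forall fun q => ?_
    rw [cuspFun, Complex.ofReal_mul, Complex.mul_cpow_ofReal_nonneg (by positivity) (by positivity),
      Complex.ofReal_mul, Complex.mul_cpow_ofReal_nonneg (by positivity) (by positivity)]
  have i₁ : Integrable f₁ (Measure.count.withDensity fun m => ENNReal.ofReal |(m.1 : ℝ)|) := by
    rw [integrable_withDensity_iff_integrable_smul' .of_discrete (by simp)]
    simp_rw [e₁]
    rw [integrable_count_iff]
    exact summable_natAbs_cpow hw
  have hre : (-s - 1).re < -1 := by simp; linarith
  have i₂ : Integrable f₂ (((volume : Measure ℝ).restrict (Set.Ioi T)).withDensity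
      fun y => ENNReal.ofReal y⁻¹) := by
    rw [integrable_withDensity_iff_integrable_smul' (by fun_prop) (by simp)]
    exact (integrableOn_Ioi_cpow_of_lt hre hT0).congr_fun (fun y hy => (e₂ y hy).symm)
      measurableSet_Ioi
  have i₃ : Integrable f₃ := integrable_inv_one_add_sq_cpow (by linarith)
  have hI := i₁.mul_prod (i₂.mul_prod i₃)
  refine ⟨hI.congr hprod, ?_⟩
  rw [← integral_congr_ae hprod, cuspMeasure, integral_prod_mul f₁ fun q : ℝ × ℝ => f₂ q.1 * f₃ q.2,
    integral_prod_mul f₂ f₃]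
  congr 1
  · rw [integral_withDensity_eq_integral_toReal_smul .of_discrete (by simp),
      ← tsum_natAbs_cpow hw]
    simp_rw [e₁]
    rw [integral_countable]
    · simp
    · rw [integrable_count_iff]
      exact summable_natAbs_cpow hw
  · congr 1
    rw [integral_withDensity_eq_integral_toReal_smul (by fun_prop) (by simp),
      setIntegral_congr_fun measurableSet_Ioi e₂, integral_Ioi_cpow_of_lt hre hT0,
      show -s - 1 + 1 = -s by ring, neg_div_neg_eq]

/-! ### The formula for the truncated zeta function -/

theorem two_zeta_mul_integral_cusp {s : ℂ} (hs : 1 < s.re) {T : ℝ} (hT : 1 ≤ T) :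
    2 * riemannZeta (2 * s) * ∫ p in cuspDomain T ×ˢ bigCosets, (cosetIm p : ℂ) ^ s
      ∂((volume : Measure ℍ).prod Measure.count) = 2 * riemannZeta (2 * s - 1) *
          ((T : ℂ) ^ (-s) / s * ∫ w : ℝ, (((1 + w ^ 2)⁻¹ : ℝ) : ℂ) ^ s) := by
  obtain ⟨hI, hval⟩ := integrable_cuspFun_cpow hs hT
  have hsm : AEStronglyMeasurable (fun y : ℝ => (y : ℂ) ^ s) ((cuspMeasure T).map cuspFun) :=
    Measurable.aestronglyMeasurable (by fun_prop)
  have hsm' := hsm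
  rw [← map_quad hT] at hsm'
  have hI' := (integrable_map_measure hsm measurable_cuspFun.aemeasurable).2 hI
  rw [← map_quad hT] at hI'
  have hI'' := (integrable_map_measure hsm' measurable_quad.aemeasurable).1 hI'
  rw [← hval]
  have h1 := integral_map measurable_cuspFun.aemeasurable hsm
  rw [← map_quad hT, integral_map measurable_quad.aemeasurable hsm',
    ← (integrable_tsum_of_prod_count (F := fun p : ℍ × (NonzeroInt × ℤ) =>
      (quad p.1 (p.2.1, p.2.2) : ℂ) ^ s) hI'').2] at h1
  rw [← h1, ← (setIntegral_prod_count (unfolding hs hT).2.1).2, ← integral_const_mul]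
  exact integral_congr_ae (Filter.Eventually.of_forall fun z => (tsum_quad_big z hs).symm)

theorem truncatedZeta_eq {s : ℂ} (hs : 1 < s.re) {T : ℝ} (hT : 1 ≤ T) :
    IntegrableOn (fun z : ℍ => eisensteinHat z s) (truncatedDomain T) ∧
      truncatedZeta T s =
        completedRiemannZeta (2 * s) / (s - 1) * (T : ℂ) ^ (s - 1) -
          completedRiemannZeta (2 * s - 1) / s * (T : ℂ) ^ (-s) := by
  obtain ⟨h1, -, h3⟩ := unfolding hs hT
  obtain ⟨i1, v1⟩ := setIntegral_prod_count h1
  have he : ∀ z, ∑' c : (Set.univ : Set Cosets), (cosetIm (z, c) : ℂ) ^ s = eisenstein z s := by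
    intro z
    rw [tsum_univ fun c => (cosetIm (z, c) : ℂ) ^ s, eisenstein]
    exact tsum_congr fun c => (eisensteinTerm_eq z s c).symm
  simp_rw [he] at i1 v1
  refine ⟨i1.const_mul _, ?_⟩
  have hc := two_zeta_mul_integral_cusp hs hT
  have hG := Gamma_mul_integral_inv_one_add_sq (s := s) (by linarith)
  have hw : 1 < (2 * s).re := by simp; linarith
  have hw' : 1 < (2 * s - 1).re := by simp; linarith
  have hpi : ((Real.pi : ℝ) : ℂ) ≠ 0 := by exact_mod_cast Real.pi_pos.ne'
  simp only [truncatedZeta, eisensteinHat]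
  rw [integral_const_mul, v1, eq_sub_of_add_eq h3, completedZeta_eq hw, completedZeta_eq hw',
    show (2 * s - 1) / 2 = s - 1 / 2 by ring, show 2 * s / 2 = s by ring,
    show -(2 * s - 1) / 2 = -(2 * s) / 2 + 1 / 2 by ring, Complex.cpow_add _ _ hpi]
  set J := ∫ p in cuspDomain T ×ˢ bigCosets, (cosetIm p : ℂ) ^ s
      ∂((volume : Measure ℍ).prod Measure.count)
  set B := ∫ w : ℝ, (((1 + w ^ 2)⁻¹ : ℝ) : ℂ) ^ s
  -- `hc` is scaled to trade `ξ(2s) J` for a multiple of `Γ(s) B`; `hG` then replaces `Γ(s) B` by `π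
  -- ^ (1/2) Γ(s - 1/2)`, the factors needed for `ξ(2s - 1)`.
  linear_combination (-((Real.pi : ℝ) : ℂ) ^ (-(2 * s) / 2) * Complex.Gamma s / 2) * hc -
    (((Real.pi : ℝ) : ℂ) ^ (-(2 * s) / 2) * riemannZeta (2 * s - 1) * (T : ℂ) ^ (-s) / s) * hG

/-! ### Covolume, coordinates and semi-stability of lattices -/

theorem covolume_span_basis (b : Module.Basis (Fin 2) ℝ ℂ) :
    ZLattice.covolume (Submodule.span ℤ (Set.range b)) = |Complex.basisOneI.det b| := by
  rw [ZLattice.covolume_eq_det_mul_measureReal _ _ (b.restrictScalars ℤ)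
    Complex.orthonormalBasisOneI.toBasis]
  have h1 : volume.real (ZSpan.fundamentalDomain Complex.orthonormalBasisOneI.toBasis) = 1 := by
    rw [Measure.real, measure_congr (ZSpan.fundamentalDomain_ae_parallelepiped
      Complex.orthonormalBasisOneI.toBasis volume), OrthonormalBasis.coe_toBasis,
      OrthonormalBasis.volume_parallelepiped, ENNReal.toReal_one]
  rw [h1, mul_one, Complex.toBasis_orthonormalBasisOneI]
  congr 2
  ext i
  simp

theorem vol_lattice (z : ℍ) {t : ℝ} (ht : 0 < t) : vol (lattice z t) = t ^ 2 := by
  have hy := z.im_pos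
  set a : ℝ := t / √z.im with ha
  have ha0 : 0 < a := by positivity
  have hai : a ^ 2 * z.im = t ^ 2 := by
    rw [ha, div_pow, Real.sq_sqrt hy.le, div_mul_cancel₀ _ hy.ne']
  have hli : LinearIndependent ℝ ![(a : ℂ) * (z : ℂ), (a : ℂ)] := by
    rw [LinearIndependent.pair_iff]
    intro u v h
    have him := congrArg Complex.im h
    have hre := congrArg Complex.re h
    simp at him hre
    have hu : u = 0 := by
      rcases him with h | h | h
      · exact h
      · exact absurd h ha0.ne'
      · exact absurd h hy.ne'
    subst hu
    simpa [ha0.ne'] using hre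
  set b := basisOfLinearIndependentOfCardEqFinrank hli (by simp) with hb
  have hbc : (b : Fin 2 → ℂ) = ![(a : ℂ) * (z : ℂ), (a : ℂ)] :=
    coe_basisOfLinearIndependentOfCardEqFinrank hli _
  have hL : lattice z t = Submodule.span ℤ (Set.range b) := by
    rw [hbc, Matrix.range_cons, Matrix.range_cons, Matrix.range_empty, Set.union_empty]
    rfl
  rw [vol, hL, covolume_span_basis, hbc, Module.Basis.det_apply, Matrix.det_fin_two]
  simp only [Module.Basis.toMatrix_apply, Complex.coe_basisOneI_repr]
  simp
  rw [abs_of_pos ha0, abs_of_pos hy, ← hai]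
  ring

/-- The vector of `lattice z t` with given integral coordinates. -/
noncomputable def latticeVec (z : ℍ) (t : ℝ) (v : ℤ × ℤ) : ℂ :=
  ((t / √z.im : ℝ) : ℂ) * ((v.1 : ℂ) * (z : ℂ) + v.2)

theorem mem_lattice_iff {z : ℍ} {t : ℝ} {x : ℂ} :
    x ∈ lattice z t ↔ ∃ v, latticeVec z t v = x := by
  rw [lattice, Submodule.mem_span_pair]
  constructor
  · rintro ⟨m, n, h⟩
    refine ⟨(m, n), ?_⟩
    rw [← h, latticeVec]
    simp only [zsmul_eq_mul]
    ring
  · rintro ⟨⟨m, n⟩, h⟩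
    refine ⟨m, n, ?_⟩
    rw [← h, latticeVec]
    simp only [zsmul_eq_mul]
    ring

theorem norm_latticeVec_sq (z : ℍ) (t : ℝ) (v : ℤ × ℤ) :
    ‖latticeVec z t v‖ ^ 2 = t ^ 2 * (quad z v)⁻¹ := by
  rw [latticeVec, norm_mul, mul_pow, Complex.norm_real, Real.norm_eq_abs, sq_abs, div_pow,
    Real.sq_sqrt z.im_pos.le, ← Complex.normSq_eq_norm_sq, quad, inv_div]
  ring

theorem latticeVec_ne_zero {z : ℍ} {t : ℝ} (ht : 0 < t) {v : ℤ × ℤ} (hv : v ≠ 0) :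
    latticeVec z t v ≠ 0 := by
  intro h
  have h1 := norm_latticeVec_sq z t v
  rw [h, norm_zero] at h1
  have := quad_pos z hv
  have : 0 < t ^ 2 * (quad z v)⁻¹ := by positivity
  linarith [h1]

theorem latticeVec_injective (z : ℍ) {t : ℝ} (ht : 0 < t) :
    Function.Injective (latticeVec z t) := by
  intro v w h
  by_contra hc
  refine latticeVec_ne_zero (z := z) ht (sub_ne_zero.2 hc) ?_
  rw [← sub_eq_zero] at h
  rw [← h]
  simp only [latticeVec, Prod.fst_sub, Prod.snd_sub]
  push_cast
  ring

/-- Integral coordinates on `lattice z t`. -/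
noncomputable def latticeEquiv (z : ℍ) {t : ℝ} (ht : 0 < t) : ℤ × ℤ ≃ lattice z t :=
  Equiv.ofBijective (fun v => ⟨latticeVec z t v, mem_lattice_iff.2 ⟨v, rfl⟩⟩)
    ⟨fun _ _ h => latticeVec_injective z ht (congrArg Subtype.val h), fun x => by
      obtain ⟨v, hv⟩ := mem_lattice_iff.1 x.2
      exact ⟨v, Subtype.ext hv⟩⟩

/-- For `z ∈ 𝒟` the vector with coordinates `(0, 1)` is a shortest nonzero one, of squared length `t
^ 2 / y`, while the covolume is `t ^ 2`. -/
theorem isSemistable_lattice_iff {z : ℍ} (hz : z ∈ (𝒟 : Set ℍ)) {t : ℝ} (ht : 0 < t) :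
    IsSemistable (lattice z t) ↔ z.im ≤ 1 := by
  rw [IsSemistable, vol_lattice z ht]
  have ht2 : 0 < t ^ 2 := by positivity
  have hy := z.im_pos
  constructor
  · intro h
    have hv : ((0, 1) : ℤ × ℤ) ≠ 0 := by simp
    have h1 := h _ (mem_lattice_iff.2 ⟨(0, 1), rfl⟩) (latticeVec_ne_zero ht hv)
    rw [norm_latticeVec_sq, quad] at h1
    simp only [Int.cast_zero, zero_mul, Int.cast_one, zero_add, map_one, div_one] at h1
    have h2 : 1 ≤ (z.im)⁻¹ := by
      by_contra hc
      push Not at hc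
      nlinarith
    exact (one_le_inv₀ hy).1 h2
  · intro h x hx hx0
    obtain ⟨v, rfl⟩ := mem_lattice_iff.1 hx
    have hv : v ≠ 0 := by
      rintro rfl
      exact hx0 (by simp [latticeVec])
    have hv' : v.1 ≠ 0 ∨ v.2 ≠ 0 := by
      by_contra! hc
      exact hv (Prod.ext hc.1 hc.2)
    have h1 := one_le_normSq_linear hz hv'
    have h2 : quad z v ≤ 1 := by
      rw [quad, div_le_one (by linarith)]
      linarith
    rw [norm_latticeVec_sq]
    exact le_mul_of_one_le_right ht2.le ((one_le_inv₀ (quad_pos z hv)).2 h2)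

theorem semistableModuli_eq : semistableModuli = truncatedDomain 1 ×ˢ Set.Ioi 0 := by
  ext ⟨z, t⟩
  constructor
  · rintro ⟨h1, h2, h3⟩
    exact ⟨⟨h1, (isSemistable_lattice_iff h1 h2).1 h3⟩, h2⟩
  · rintro ⟨⟨h1, h3⟩, h2⟩
    exact ⟨h1, h2, (isSemistable_lattice_iff h1 h2).2 h3⟩

/-! ### Theta series, their Mellin transforms and the non-abelian zeta function -/

/-- The Gaussian `exp (-π ‖x‖ ^ 2)` at a nonzero lattice vector, in terms of `q = quad z v`; it is
zero for `q = 0`, that is, at the origin. -/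
noncomputable def gaussTerm (q t : ℝ) : ℝ := if q = 0 then 0 else Real.exp (-(Real.pi / q * t ^ 2))

theorem gaussTerm_nonneg (q t : ℝ) : 0 ≤ gaussTerm q t := by
  unfold gaussTerm
  split_ifs
  · exact le_rfl
  · exact (Real.exp_pos _).le

theorem summable_gaussTerm (z : ℍ) {t : ℝ} (ht : 0 < t) :
    Summable fun v : ℤ × ℤ => gaussTerm (quad z v) t := by
  -- The constant comes from `e ^ (-x) ≤ 2 / x ^ 2` at `x = π t ^ 2 / q`; any exponent above `1`
  -- would do.
  have h := (summable_quad_rpow z (σ := 2) (by norm_num)).mul_left (2 / (Real.pi * t ^ 2) ^ 2)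
  refine Summable.of_nonneg_of_le (fun v => gaussTerm_nonneg _ _) (fun v => ?_) h
  have hq0 := quad_nonneg z v
  generalize quad z v = q at hq0
  unfold gaussTerm
  have hpi := Real.pi_pos
  split_ifs with hq
  · positivity
  · have hq' : 0 < q := lt_of_le_of_ne hq0 (Ne.symm hq)
    have hx : 0 < Real.pi / q * t ^ 2 := by positivity
    have h1 := Real.pow_div_factorial_le_exp (Real.pi / q * t ^ 2) hx.le 2
    rw [Real.exp_neg, Real.rpow_two]
    have h2 : 2 / (Real.pi * t ^ 2) ^ 2 * q ^ 2 =
        ((Real.pi / q * t ^ 2) ^ 2 / (Nat.factorial 2 : ℕ))⁻¹ := by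
      simp only [Nat.factorial_two, Nat.cast_ofNat]
      field_simp
    rw [h2]
    exact inv_anti₀ (by positivity) h1

theorem exp_h0_sub_one (z : ℍ) {t : ℝ} (ht : 0 < t) :
    Real.exp (h0 (lattice z t)) - 1 = ∑' v : ℤ × ℤ, gaussTerm (quad z v) t := by
  have hterm : ∀ v : ℤ × ℤ, Real.exp (-Real.pi * ‖((latticeEquiv z ht v : lattice z t) : ℂ)‖ ^ 2) =
      gaussTerm (quad z v) t + if v = 0 then 1 else 0 := by
    intro v
    change Real.exp (-Real.pi * ‖latticeVec z t v‖ ^ 2) = _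
    rw [norm_latticeVec_sq, gaussTerm]
    by_cases hv : v = 0
    · subst hv
      simp [quad_zero]
    · rw [if_neg (quad_pos z hv).ne', if_neg hv, add_zero]
      congr 1
      rw [div_eq_mul_inv]
      ring
  have hone : HasSum (fun v : ℤ × ℤ => if v = 0 then (1 : ℝ) else 0) 1 := hasSum_ite_eq 0 1
  have hsum : ∑' x : lattice z t, Real.exp (-Real.pi * ‖(x : ℂ)‖ ^ 2) =
      (∑' v : ℤ × ℤ, gaussTerm (quad z v) t) + 1 := by
    rw [← (latticeEquiv z ht).tsum_eq, tsum_congr hterm,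
      (summable_gaussTerm z ht).tsum_add hone.summable, hone.tsum_eq]
  have hnn : 0 ≤ ∑' v : ℤ × ℤ, gaussTerm (quad z v) t := tsum_nonneg fun v => gaussTerm_nonneg _ _
  rw [h0, hsum, Real.exp_log (by linarith), add_sub_cancel_right]

/-- The measure `dt / t` on the positive half-line. -/
noncomputable def scaleMeasure : Measure ℝ :=
  ((volume : Measure ℝ).restrict (Set.Ioi 0)).withDensity fun t => ENNReal.ofReal t⁻¹

instance : SFinite scaleMeasure := by unfold scaleMeasure; infer_instance

theorem moduliMeasure_restrict :
    moduliMeasure.restrict semistableModuli =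
      ((volume : Measure ℍ).restrict (truncatedDomain 1)).prod scaleMeasure := by
  rw [semistableModuli_eq, moduliMeasure, ← Measure.prod_restrict,
    restrict_withDensity measurableSet_Ioi]
  rfl

theorem ae_scaleMeasure_pos : ∀ᵐ t ∂scaleMeasure, 0 < t :=
  (withDensity_absolutelyContinuous _ _).ae_le (ae_restrict_mem measurableSet_Ioi)

/-- The Mellin integrand attached to `gaussTerm`. -/
noncomputable def mellinTerm (s : ℂ) (q t : ℝ) : ℂ := (gaussTerm q t : ℂ) * ((t ^ 2 : ℝ) : ℂ) ^ s

theorem measurable_mellinTerm (s : ℂ) : Measurable fun p : ℝ × ℝ => mellinTerm s p.1 p.2 := by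
  unfold mellinTerm gaussTerm
  have : MeasurableSet {p : ℝ × ℝ | p.1 = 0} := measurableSet_eq_fun measurable_fst measurable_const
  have h : Measurable fun p : ℝ × ℝ =>
      if p.1 = 0 then (0 : ℝ) else Real.exp (-(Real.pi / p.1 * p.2 ^ 2)) :=
    Measurable.ite this measurable_const (by fun_prop)
  fun_prop

theorem norm_mellinTerm {s : ℂ} (hs : 0 < s.re) (q t : ℝ) :
    ‖mellinTerm s q t‖ = (mellinTerm s.re q t).re := by
  rw [mellinTerm, norm_mul, norm_ofReal_cpow (by positivity) hs, Complex.norm_real,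
    Real.norm_of_nonneg (gaussTerm_nonneg q t), mellinTerm, ← Complex.ofReal_cpow (by positivity),
    ← Complex.ofReal_mul, Complex.ofReal_re]

/-- The substitution `u = t ^ 2` turns `dt / t` into `du / (2u)` and leaves a Gamma integral. At `q
= 0`, the origin, both sides vanish. -/
theorem mellinTerm_integral {s : ℂ} (hs : 0 < s.re) {q : ℝ} (hq : 0 ≤ q) :
    Integrable (mellinTerm s q) scaleMeasure ∧
      ∫ t, mellinTerm s q t ∂scaleMeasure =
        ((Real.pi : ℝ) : ℂ) ^ (-s) * Complex.Gamma s / 2 * (q : ℂ) ^ s := by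
  have hs0 : s ≠ 0 := fun h => by simp [h] at hs
  rcases hq.eq_or_lt with rfl | hq
  · have : mellinTerm s 0 = fun _ => 0 := by
      ext t
      simp [mellinTerm, gaussTerm]
    rw [this]
    simp [Complex.zero_cpow hs0]
  · have hr : 0 < Real.pi / q := by positivity
    set g : ℝ → ℂ := fun u => (u : ℂ) ^ (s - 1) * Complex.exp (-((Real.pi / q : ℝ) * u)) with hg
    have e : ∀ t ∈ Set.Ioi (0 : ℝ), (ENNReal.ofReal t⁻¹).toReal • mellinTerm s q t =
        t ^ ((2 : ℝ) - 1) • g (t ^ (2 : ℝ)) := by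
      intro t ht
      have ht0 : 0 < t := ht
      have ht' : (t : ℂ) ≠ 0 := by exact_mod_cast ht0.ne'
      have ht2 : ((t ^ 2 : ℝ) : ℂ) ≠ 0 := by exact_mod_cast (by positivity : t ^ 2 ≠ 0)
      rw [ENNReal.toReal_ofReal (by positivity), mellinTerm, gaussTerm, if_neg hq.ne', hg,
        show (2 : ℝ) - 1 = 1 by norm_num, Real.rpow_one, Real.rpow_two]
      simp only [Complex.real_smul]
      rw [Complex.cpow_sub _ _ ht2, Complex.cpow_one]
      push_cast
      field_simp
    have hI := integrableOn_cpow_mul_exp hs hr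
    constructor
    · rw [scaleMeasure, integrable_withDensity_iff_integrable_smul' (by fun_prop) (by simp)]
      exact ((integrableOn_Ioi_comp_rpow_iff' g two_ne_zero).2 hI).congr_fun
        (fun t ht => (e t ht).symm) measurableSet_Ioi
    · rw [scaleMeasure, integral_withDensity_eq_integral_toReal_smul (by fun_prop) (by simp),
        setIntegral_congr_fun measurableSet_Ioi e]
      have h1 := integral_comp_rpow_Ioi_of_pos (g := g) two_pos
      have h2 : ∫ t in Set.Ioi (0 : ℝ), ((2 : ℝ) * t ^ ((2 : ℝ) - 1)) • g (t ^ (2 : ℝ)) =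
          2 * ∫ t in Set.Ioi (0 : ℝ), t ^ ((2 : ℝ) - 1) • g (t ^ (2 : ℝ)) := by
        rw [← integral_const_mul]
        refine integral_congr_ae (Filter.Eventually.of_forall fun t => ?_)
        simp only [Complex.real_smul]
        push_cast
        ring
      rw [h2] at h1
      have h3 := Gamma_mul_inv_cpow hs hr
      rw [← h1, inv_div, div_eq_mul_inv, mul_comm q, Complex.ofReal_mul,
        Complex.mul_cpow_ofReal_nonneg (by positivity) hq.le, Complex.ofReal_inv,
        Complex.inv_cpow _ _ (by
          rw [Complex.arg_ofReal_of_nonneg Real.pi_pos.le]; exact Real.pi_pos.ne),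
        ← Complex.cpow_neg] at h3
      linear_combination (-1 / 2) * h3

/-- The factor `1/2` from the Mellin transform cancels the `2` in `2 ζ(2s) E(z, s)`, leaving `π ^
(-s) Γ(s) ζ(2s) E(z, s)`. The interchange is justified by the same computation at the exponent `Re
s`. -/
theorem integral_tsum_mellinTerm (z : ℍ) {s : ℂ} (hs : 1 < s.re) :
    Integrable (fun t => ∑' v : ℤ × ℤ, mellinTerm s (quad z v) t) scaleMeasure ∧
      ∫ t, ∑' v : ℤ × ℤ, mellinTerm s (quad z v) t ∂scaleMeasure = eisensteinHat z s := by
  have hs0 : 0 < s.re := by linarith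
  set F : ℝ × (ℤ × ℤ) → ℂ := fun p => mellinTerm s (quad z p.2) p.1 with hF
  have hFm : Measurable F := measurable_from_prod_countable_left fun v =>
    (measurable_mellinTerm s).comp
      ((measurable_const (a := quad z v)).prodMk measurable_id)
  have hsum : Summable fun v : ℤ × ℤ => (quad z v : ℂ) ^ s := by
    refine Summable.of_norm ((summable_quad_rpow z hs).congr fun v => ?_)
    rw [norm_ofReal_cpow (quad_nonneg z v) hs0]
  have hnorm : ∀ v : ℤ × ℤ, ∫ t, ‖F (t, v)‖ ∂scaleMeasure =
      (((Real.pi : ℝ) : ℂ) ^ (-(s.re : ℂ)) * Complex.Gamma s.re / 2 *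
        (quad z v : ℂ) ^ (s.re : ℂ)).re := by
    intro v
    have h := mellinTerm_integral (s := (s.re : ℂ)) (by simpa using hs0) (quad_nonneg z v)
    rw [← h.2]
    simp only [hF, norm_mellinTerm hs0]
    exact integral_re h.1
  have hint : Integrable F (scaleMeasure.prod Measure.count) := by
    rw [integrable_prod_iff' hFm.aestronglyMeasurable]
    refine ⟨Filter.Eventually.of_forall fun v => (mellinTerm_integral hs0 (quad_nonneg z v)).1, ?_⟩
    simp_rw [hnorm]
    rw [integrable_count_iff]
    have hre : Summable fun v : ℤ × ℤ => (quad z v : ℂ) ^ (s.re : ℂ) := by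
      refine Summable.of_norm ((summable_quad_rpow z hs).congr fun v => ?_)
      rw [norm_ofReal_cpow (quad_nonneg z v) (by simpa using hs0), Complex.ofReal_re]
    refine (hre.norm.mul_left ‖((Real.pi : ℝ) : ℂ) ^ (-(s.re : ℂ)) *
      Complex.Gamma s.re / 2‖).of_norm_bounded (g := _) fun v => ?_
    rw [norm_norm, ← norm_mul]
    exact Complex.abs_re_le_norm _
  obtain ⟨h1, h2⟩ := integrable_tsum_of_prod_count hint
  refine ⟨h1, h2.trans ?_⟩
  rw [integral_prod_symm F hint]
  have hval : ∀ v : ℤ × ℤ, ∫ t, F (t, v) ∂scaleMeasure =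
      ((Real.pi : ℝ) : ℂ) ^ (-s) * Complex.Gamma s / 2 * (quad z v : ℂ) ^ s := fun v =>
    (mellinTerm_integral hs0 (quad_nonneg z v)).2
  simp_rw [hval]
  rw [integral_countable (by rw [integrable_count_iff]; exact (hsum.mul_left _).norm)]
  simp only [Measure.real, Measure.count_singleton, ENNReal.toReal_one, one_smul]
  have hw : 1 < (2 * s).re := by simp; linarith
  rw [tsum_mul_left, tsum_quad_cpow z hs, eisensteinHat, completedZeta_eq hw, eisenstein,
    tsum_congr fun c => eisensteinTerm_eq z s c, show 2 * s / 2 = s by ring,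
    show -(2 * s) / 2 = -s by ring]
  ring

theorem zetaIntegrand_eq (z : ℍ) {t : ℝ} (ht : 0 < t) (s : ℂ) :
    zetaIntegrand s (z, t) = ∑' v : ℤ × ℤ, mellinTerm s (quad z v) t := by
  simp only [zetaIntegrand, exp_h0_sub_one z ht, vol_lattice z ht, mellinTerm]
  rw [tsum_mul_right, Complex.ofReal_tsum]

theorem nonabelianZeta_eq {s : ℂ} (hs : 1 < s.re) :
    IntegrableOn (zetaIntegrand s) semistableModuli moduliMeasure ∧
      nonabelianZeta s = truncatedZeta 1 s := by
  have hs0 : 0 < s.re := by linarith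
  set Θ : ℂ → ℍ × ℝ → ℂ := fun w p => ∑' v : ℤ × ℤ, mellinTerm w (quad p.1 v) p.2 with hΘ
  have hqm : ∀ v : ℤ × ℤ, Measurable fun z : ℍ => quad z v := by
    intro v
    simp only [quad_eq]
    have := continuous_re.measurable
    have := continuous_im.measurable
    fun_prop
  have hΘm : Measurable (Θ s) := Measurable.tsum fun v =>
    (measurable_mellinTerm s).comp (((hqm v).comp measurable_fst).prodMk measurable_snd)
  have hae : zetaIntegrand s =ᵐ[moduliMeasure.restrict semistableModuli] Θ s := by
    rw [moduliMeasure_restrict]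
    filter_upwards [Measure.quasiMeasurePreserving_snd.ae ae_scaleMeasure_pos] with p hp
    exact zetaIntegrand_eq p.1 hp s
  have hnorm : ∀ z t, 0 < t → ‖Θ s (z, t)‖ = (Θ s.re (z, t)).re := by
    intro z t ht
    simp only [hΘ]
    rw [← zetaIntegrand_eq z ht, ← zetaIntegrand_eq z ht, zetaIntegrand, zetaIntegrand]
    simp only [exp_h0_sub_one z ht, vol_lattice z ht]
    have hnn : 0 ≤ ∑' v : ℤ × ℤ, gaussTerm (quad z v) t :=
      tsum_nonneg fun v => gaussTerm_nonneg _ _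
    rw [norm_mul, norm_ofReal_cpow (by positivity) hs0, Complex.norm_real,
      Real.norm_of_nonneg hnn, ← Complex.ofReal_cpow (by positivity), ← Complex.ofReal_mul,
      Complex.ofReal_re]
  have hre : 1 < ((s.re : ℂ)).re := by simpa using hs
  have hint : Integrable (Θ s)
      (((volume : Measure ℍ).restrict (truncatedDomain 1)).prod scaleMeasure) := by
    rw [integrable_prod_iff hΘm.aestronglyMeasurable]
    refine ⟨Filter.Eventually.of_forall fun z => (integral_tsum_mellinTerm z hs).1, ?_⟩
    -- By positivity of the theta series, the integral of the norm over `t` is `Ê(z, Re s)`, already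
    -- known to be integrable over `𝒟_1`.
    refine ((truncatedZeta_eq hre le_rfl).1.re).congr (Filter.Eventually.of_forall fun z => ?_)
    have h := integral_tsum_mellinTerm z hre
    simp only
    rw [← h.2]
    refine (integral_re h.1).symm.trans (integral_congr_ae ?_)
    filter_upwards [ae_scaleMeasure_pos] with t ht
    exact (hnorm z t ht).symm
  refine ⟨?_, ?_⟩
  · rw [IntegrableOn, integrable_congr hae, moduliMeasure_restrict]
    exact hint
  · rw [nonabelianZeta, integral_congr_ae hae, moduliMeasure_restrict, integral_prod _ hint,
      truncatedZeta]
    exact integral_congr_ae (Filter.Eventually.of_forall fun z =>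
      (integral_tsum_mellinTerm z hs).2)

end RankTwoZeta

theorem mainTheorem4 (s : ℂ) (hs : 1 < s.re) :
    (∀ z : ℍ, Summable (RankTwoZeta.eisensteinTerm z s)) ∧
    (∀ T : ℝ, 1 ≤ T →
      IntegrableOn (fun z : ℍ => RankTwoZeta.eisensteinHat z s)
        (RankTwoZeta.truncatedDomain T) ∧
      RankTwoZeta.truncatedZeta T s =
        completedRiemannZeta (2 * s) / (s - 1) * (T : ℂ) ^ (s - 1) -
          completedRiemannZeta (2 * s - 1) / s * (T : ℂ) ^ (-s)) ∧
    IntegrableOn (RankTwoZeta.zetaIntegrand s) RankTwoZeta.semistableModuli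
      RankTwoZeta.moduliMeasure ∧
    RankTwoZeta.nonabelianZeta s =
      completedRiemannZeta (2 * s) / (s - 1) - completedRiemannZeta (2 * s - 1) / s := by
  have h1 := RankTwoZeta.truncatedZeta_eq hs le_rfl
  have h2 := RankTwoZeta.nonabelianZeta_eq hs
  refine ⟨fun z => RankTwoZeta.summable_eisensteinTerm z hs,
    fun T hT => RankTwoZeta.truncatedZeta_eq hs hT, h2.1, ?_⟩
  rw [h2.2, h1.2]
  simp
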